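/- Let $0<r\le 1$ and let $(E,\|\cdot\|_E)$ be a separable real $r$-Banach space: $\|\lambda x\|_E=|\lambda|\,\|x\|_E$, $\|x\|_E=0$ iff $x=0$, $\|x+y\|_E^r\le\|x\|_E^r+\|y\|_E^r$, and $E$ is complete for the metric $\|x-y\|_E^r$. Let $H$ be a separable real Hilbert space, $T\in(0,\infty)$, $\mathcal H:=L^2(0,T;H)$, and let $W_H\colon\mathcal H\to L^2(\Omega)$ be an $\mathcal H$-isonormal process on a probability space $(\Omega,\mathcal F,\mathbb P)$, i.e. each $W_H(f)$ is a centred Gaussian random variable and $\mathbb E[W_H(f)W_H(g)]=\langle f,g\rangle_{\mathcal H}$. For a linear operator $R\colon\mathcal H\to E$ and $0<p<\infty$ put $$\|R\|_{\gamma^p(\mathcal H,E)}:=\sup\Big(\mathbb E\Big\|\sum_{n=1}^N\gamma_n Rf_n\Big\|_E^p\Big)^{1/p},$$ where the supremum is over all finite orthonormal systems $f_1,\dots,f_N$ in $\mathcal H$ and $\gamma_1,\gamma_2,\dots$ are independent standard Gaussian random variables. Let $\gamma(\mathcal H,E)$ be the closure, with respect to $\|\cdot\|_{\gamma(\mathcal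 H,E)}:=\|\cdot\|_{\gamma^2(\mathcal H,E)}$, of the finite rank operators $\sum_{n=1}^N f_n\otimes x_n\colon f\mapsto\sum_{n=1}^N\langle f,f_n\rangle x_n$ ($f_1,\dots,f_N$ orthonormal in $\mathcal H$, $x_1,\dots,x_N\in E$) in the space of linear operators with $\|\cdot\|_{\gamma(\mathcal H,E)}<\infty$. The stochastic integral of such a finite rank operator is $\big(\sum_n f_n\otimes x_n\big)\cdot W_H:=\sum_n W_H(f_n)x_n$, and for $R\in\gamma(\mathcal H,E)$ a random variable is called the stochastic integral $R\cdot W_H$ if it is the limit in $L^2(\Omega;E)$ of $R_k\cdot W_H$ for some sequence of finite rank operators $R_k$ with $\|R_k-R\|_{\gamma(\mathcal H,E)}\to0$. The stochastic integral process of $R$ is $R\cdot W_H(t):=R|_{[0,t]}\cdot W_H$, $t\in[0,T]$, where $R|_{[0,t]}f:=R(\mathbf 1_{[0,t]}f)$. Let $R\in\gamma(L^2(0,T;H),E)$. Then the stochastic integral process $R\cdot W_H$ exists, is unique up to almost sure equality at each time, and has a version with continuous paths, and for every $0<p<\infty$ one has $\|R\|_{\gamma^p(L^2(0,T;H),E)}<\infty$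 and (using a continuous version) $$2^{-\frac{1-(r\wedge p)}{r\wedge p}}\,\|R\|_{\gamma^p(L^2(0,T;H),E)}\le\Big(\mathbb E\Big[\sup_{t\in[0,T]}\|R\cdot W_H(t)\|_E^p\Big]\Big)^{1/p}\le 2^{\frac1p+\frac1r-1}\,\|R\|_{\gamma^p(L^2(0,T;H),E)}.$$ -/

import Mathlib

open MeasureTheory ProbabilityTheory Filter Topology
open scoped ENNReal NNReal

/-- `E`, with the function `‖·‖ : E → ℝ`, is an `r`-normed real vector space, `0 < r ≤ 1`, and the
metric of `E` is the one induced by the `r`-norm, `dist x y = ‖x - y‖ ^ r`.  (The class `Norm E`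
is a mere notation class: it carries no laws.)  An `r`-Banach space is a complete such space. -/
class RNormedSpace (r : ℝ) (E : Type*) [AddCommGroup E] [Module ℝ E] [MetricSpace E] [Norm E] :
    Prop where
  r_pos : 0 < r
  r_le_one : r ≤ 1
  rnorm_nonneg : ∀ x : E, 0 ≤ ‖x‖
  rnorm_smul : ∀ (c : ℝ) (x : E), ‖c • x‖ = |c| * ‖x‖
  rnorm_eq_zero_iff : ∀ x : E, ‖x‖ = 0 ↔ x = 0
  rnorm_add_rpow_le : ∀ x y : E, ‖x + y‖ ^ r ≤ ‖x‖ ^ r + ‖y‖ ^ r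
  dist_eq_rpow : ∀ x y : E, dist x y = ‖x - y‖ ^ r

section Radonifying

variable {K E : Type*} [NormedAddCommGroup K] [InnerProductSpace ℝ K]
  [AddCommGroup E] [Module ℝ E] [Norm E]

/-- The quantity `‖R‖_{γ^p_∞(K,E)} ∈ [0,∞]`: the supremum over all finite orthonormal systems
`h₁, …, h_N` of `(𝔼 ‖∑ γ_n R h_n‖ ^ p) ^ (1/p)`.  The expectation depends only on the law of the
independent standard Gaussians `γ₁, …, γ_N`, the product measure on `Fin N → ℝ`. -/
noncomputable def gammaNorm (p : ℝ) (R : K →ₗ[ℝ] E) : ℝ≥0∞ :=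
  ⨆ (N : ℕ) (h : Fin N → K) (_ : Orthonormal ℝ h),
    (∫⁻ g, ENNReal.ofReal ‖∑ n, g n • R (h n)‖ ^ p
      ∂(Measure.pi fun _ : Fin N => gaussianReal 0 1)) ^ (1 / p)

/-- The operator `∑ h_n ⊗ x_n`, that is, `f ↦ ∑ ⟨f, h_n⟩ x_n`. -/
noncomputable def finiteRankOp {N : ℕ} (h : Fin N → K) (x : Fin N → E) : K →ₗ[ℝ] E :=
  ∑ n, (innerₗ K (h n)).smulRight (x n)

/-- `R` belongs to `γ(K,E)`: it is `γ`-summing and lies in the closure of the finite rank operators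
with respect to `‖·‖_{γ_∞(K,E)} = ‖·‖_{γ^2_∞(K,E)}`.  (Boundedness of `R` follows.) -/
def IsGammaRadonifying (R : K →ₗ[ℝ] E) : Prop :=
  gammaNorm 2 R < ∞ ∧
    ∀ ε : ℝ≥0∞, 0 < ε → ∃ (N : ℕ) (h : Fin N → K) (x : Fin N → E),
      Orthonormal ℝ h ∧ gammaNorm 2 (R - finiteRankOp h x) < ε

end Radonifying

section Integral

variable {Ω K E : Type*} [MeasurableSpace Ω] {P : Measure Ω}
  [NormedAddCommGroup K] [InnerProductSpace ℝ K]
  [AddCommGroup E] [Module ℝ E] [Norm E] [MeasurableSpace E]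

/-- `W : K → L²(Ω)` is a `K`-isonormal process: every `W h` is a centred Gaussian variable and
`𝔼 (W h₁ * W h₂) = ⟨h₁, h₂⟩`.  (Linearity of `W` follows.) -/
structure IsIsonormal (W : K → Lp ℝ 2 P) : Prop where
  gaussian : ∀ h : K, ∃ v : ℝ≥0, P.map (W h) = gaussianReal 0 v
  covariance : ∀ h₁ h₂ : K, ∫ ω, W h₁ ω * W h₂ ω ∂P = inner ℝ h₁ h₂

/-- The stochastic integral `∑ W(h_n) x_n` of the finite rank operator `∑ h_n ⊗ x_n`
(used for orthonormal `h`). -/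
noncomputable def finiteRankIntegral (W : K → Lp ℝ 2 P) {N : ℕ} (h : Fin N → K) (x : Fin N → E) :
    Ω → E :=
  fun ω => ∑ n, W (h n) ω • x n

/-- The random variable `X` is (a representative of) the stochastic integral `R · W`: there is a
sequence of finite rank operators that converges to `R` in `γ(K,E)` and whose stochastic integrals
converge to `X` in `L²(Ω;E)`. -/
def IsStochIntegral (W : K → Lp ℝ 2 P) (R : K →ₗ[ℝ] E) (X : Ω → E) : Prop :=
  AEMeasurable X P ∧
    ∃ (N : ℕ → ℕ) (h : ∀ k, Fin (N k) → K) (x : ∀ k, Fin (N k) → E),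
      (∀ k, Orthonormal ℝ (h k)) ∧
      Tendsto (fun k => gammaNorm 2 (R - finiteRankOp (h k) (x k))) atTop (𝓝 0) ∧
      Tendsto (fun k => ∫⁻ ω, ENNReal.ofReal ‖X ω - finiteRankIntegral W (h k) (x k) ω‖ ^ (2 : ℝ) ∂P)
        atTop (𝓝 0)

end Integral

/-- The Hilbert space `L²(0,T;H)`. -/
abbrev L2Time (T : ℝ) (H : Type*) [NormedAddCommGroup H] : Type _ :=
  Lp H 2 (volume.restrict (Set.Icc (0 : ℝ) T))

section TimeDependent

variable {H : Type*} [NormedAddCommGroup H] [InnerProductSpace ℝ H] {T : ℝ}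

/-- The operator `f ↦ 𝟙_{[0,t]} f` on `L²(0,T;H)`. -/
noncomputable def cutoff (t : ℝ) : L2Time T H →ₗ[ℝ] L2Time T H where
  toFun f := ((Lp.memLp f).indicator (measurableSet_Icc (a := (0 : ℝ)) (b := t))).toLp
    ((Set.Icc (0 : ℝ) t).indicator f)
  map_add' f g := by
    rw [← MemLp.toLp_add]
    apply MemLp.toLp_congr
    filter_upwards [Lp.coeFn_add f g] with s hs
    by_cases h : s ∈ Set.Icc (0 : ℝ) t
    · simpa only [Set.indicator_of_mem h, Pi.add_apply] using hs
    · simp only [Set.indicator_of_notMem h, Pi.add_apply, add_zero]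
  map_smul' c f := by
    rw [RingHom.id_apply, ← MemLp.toLp_const_smul]
    apply MemLp.toLp_congr
    filter_upwards [Lp.coeFn_smul c f] with s hs
    by_cases h : s ∈ Set.Icc (0 : ℝ) t
    · simpa only [Set.indicator_of_mem h, Pi.smul_apply] using hs
    · simp only [Set.indicator_of_notMem h, Pi.smul_apply, smul_zero]

/-- `Y` is (a version of) the stochastic integral process `R · W_H (t) = R|_{[0,t]} · W_H`,
`t ∈ [0,T]`, where `R|_{[0,t]} f = R (𝟙_{[0,t]} f)`. -/
def IsStochIntegralProcess {Ω E : Type*} [MeasurableSpace Ω] {P : Measure Ω}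
    [AddCommGroup E] [Module ℝ E] [Norm E] [MeasurableSpace E]
    (W : L2Time T H → Lp ℝ 2 P) (R : L2Time T H →ₗ[ℝ] E) (Y : Set.Icc (0 : ℝ) T → Ω → E) : Prop :=
  ∀ t : Set.Icc (0 : ℝ) T, IsStochIntegral W (R ∘ₗ cutoff (t : ℝ)) (Y t)

end TimeDependent

/-! Everything rests on one symmetry. If `A` is a symmetric projection of the Hilbert space `K`,
then the reflection `2A - 1` is an isometry, so a Gaussian family `W (a i)` and its reflected family
have the same joint law (`IsIsonormal.map_pi_eq`). This replaces martingale and convexity arguments,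
which are not at hand in an `r`-normed space.

Upper bound. For a finite rank integral with terminal value `Z` and value `Y_t` at time `t`,
reflecting in the range of the cutoff to `[0,t]` fixes all `Y_s` with `s ≤ t` and turns `Z` into `Z'
= 2 Y_t - Z`. Since `Y_t` is the half-sum of `Z` and `Z'`, its `r`-norm is at most `2^(1/r - 1)`
times the larger of theirs. Decomposing according to the first passage over a level gives Lévy's
inequality with a factor `2` for the probabilities (`IsIsonormal.measure_exists_lt_le`), and
integrating the tails gives the constant `2^(1/p + 1/r - 1)`.

To reach a general `R`, it is approximated by its compressions `R P_k` to finite-dimensional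
subspaces (`IsGammaRadonifying.exists_approx`). Compressions have `p`-th moments bounded by the
`γ^p`-norm of `R` itself, for every `p`. A geometric rate in the `γ^2`-norm makes the integrals
converge almost surely, and Fatou's lemma passes to the limit, so approximation in `γ^p` is never
needed. As all integrals of `R` cut off at `t` are almost sure limits of one sequence
(`IsGammaRadonifying.ae_tendsto_process`), they agree almost surely.

Lower bound. For orthonormal `f_n` spanning the range of a projection `Q`, the integral `X` of `R`
and the integral `X'` of `R (2Q - 1)` have the same law, and `X + X' = 2 ∑ W(f_n) R f_n`. The
quasi-triangle inequality for `p`-th powers gives the constant (`two_rpow_mul_gaussMoment_le`); then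
`X` is taken to be the value at time `T`.

Finiteness of every `γ^p`-norm is Fernique's argument: invariance of a Gaussian pair under rotation
by 45 degrees makes the tails decay doubly exponentially along a geometric sequence of levels
(`gaussSum_measure_mul_le`).

Continuity. A scalar process `W (A_t f)` is handled by fourth moments, the maximal inequality over
short intervals and a telescoping sum; finite rank processes follow by addition. The maximal
inequality shows that these approximate the general process uniformly in time, in probability. The
resulting uniform continuity in probability, with bounds independent of the finite set of times,
makes almost all paths uniformly continuous on a countable dense set, whence a continuous version by
extension. -/

set_option linter.unusedSectionVars false

/-! ### Inequalities and topology in `r`-normed spaces -/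

section RNorm

variable {E : Type*} [AddCommGroup E] [Module ℝ E] [MetricSpace E] [Norm E]

/-- The `r`-norm with values in `[0, ∞]`. -/
noncomputable def rnorm {E : Type*} [Norm E] (x : E) : ℝ≥0∞ := ENNReal.ofReal ‖x‖

theorem rnorm_ne_top {E : Type*} [Norm E] (x : E) : rnorm x ≠ ∞ := ENNReal.ofReal_ne_top

theorem rnorm_smul (r : ℝ) [RNormedSpace r E] (c : ℝ) (x : E) :
    rnorm (c • x) = ENNReal.ofReal |c| * rnorm x := by
  rw [rnorm, RNormedSpace.rnorm_smul r, ENNReal.ofReal_mul (abs_nonneg c), rnorm]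

theorem rnorm_neg (r : ℝ) [RNormedSpace r E] (x : E) : rnorm (-x) = rnorm x := by
  rw [← neg_one_smul ℝ x, rnorm_smul r]; simp

theorem rnorm_sub_comm (r : ℝ) [RNormedSpace r E] (x y : E) : rnorm (x - y) = rnorm (y - x) := by
  rw [← rnorm_neg r, neg_sub]

theorem rnorm_eq_zero (r : ℝ) [RNormedSpace r E] {x : E} : rnorm x = 0 ↔ x = 0 := by
  rw [rnorm, ENNReal.ofReal_eq_zero, ← RNormedSpace.rnorm_eq_zero_iff r x]
  exact ⟨fun h => le_antisymm h (RNormedSpace.rnorm_nonneg r x), fun h => h.le⟩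

theorem rnorm_zero (r : ℝ) [RNormedSpace r E] : rnorm (0 : E) = 0 := (rnorm_eq_zero r).2 rfl

theorem rnorm_rpow_eq_edist (r : ℝ) [RNormedSpace r E] (x y : E) :
    rnorm (x - y) ^ r = edist x y := by
  rw [edist_dist, RNormedSpace.dist_eq_rpow (r := r), rnorm,
    ENNReal.ofReal_rpow_of_nonneg (RNormedSpace.rnorm_nonneg r _)
      (RNormedSpace.r_pos (r := r) E).le]

theorem rnorm_rpow_eq_edist_zero (r : ℝ) [RNormedSpace r E] (x : E) :
    rnorm x ^ r = edist x 0 := by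
  rw [← rnorm_rpow_eq_edist r, sub_zero]

theorem rnorm_eq_edist_rpow (r : ℝ) [RNormedSpace r E] (x : E) :
    rnorm x = edist x 0 ^ (1 / r) := by
  rw [← rnorm_rpow_eq_edist_zero r, one_div, ENNReal.rpow_rpow_inv
    (RNormedSpace.r_pos (r := r) E).ne']

theorem rnorm_add_rpow_le_add (r : ℝ) [RNormedSpace r E] (x y : E) :
    rnorm (x + y) ^ r ≤ rnorm x ^ r + rnorm y ^ r := by
  have hr := (RNormedSpace.r_pos (r := r) E).le
  simp only [rnorm]
  rw [ENNReal.ofReal_rpow_of_nonneg (RNormedSpace.rnorm_nonneg r _) hr,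
    ENNReal.ofReal_rpow_of_nonneg (RNormedSpace.rnorm_nonneg r _) hr,
    ENNReal.ofReal_rpow_of_nonneg (RNormedSpace.rnorm_nonneg r _) hr,
    ← ENNReal.ofReal_add (Real.rpow_nonneg (RNormedSpace.rnorm_nonneg r _) _)
      (Real.rpow_nonneg (RNormedSpace.rnorm_nonneg r _) _)]
  exact ENNReal.ofReal_le_ofReal (RNormedSpace.rnorm_add_rpow_le x y)

/-- The constant in the quasi-triangle inequality for `‖·‖ ^ p` in an `r`-normed space. -/
noncomputable def quasiConst (r p : ℝ) : ℝ≥0∞ := 2 ^ (p / min r p - 1)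

theorem quasiConst_ne_top (r p : ℝ) : quasiConst r p ≠ ∞ :=
  ENNReal.rpow_ne_top_of_ne_zero (by norm_num) (by norm_num)

/-- Both cases apply the power `p / r` to `r`-subadditivity: it is subadditive when `p ≤ r`, and
convex when `r ≤ p`, which costs `2^(p/r - 1)`. The exponent with `min r p` covers both cases and is
the source of `r ∧ p` in the lower bound. -/
theorem rnorm_add_rpow_le (r : ℝ) [RNormedSpace r E] {p : ℝ} (hp : 0 < p) (x y : E) :
    rnorm (x + y) ^ p ≤ quasiConst r p * (rnorm x ^ p + rnorm y ^ p) := by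
  have hr := RNormedSpace.r_pos (r := r) E
  rw [quasiConst]
  rcases le_total p r with h | h
  · rw [min_eq_right h, div_self hp.ne', sub_self, ENNReal.rpow_zero, one_mul]
    have key : rnorm (x + y) ^ p ≤ (rnorm x ^ r + rnorm y ^ r) ^ (p / r) := by
      calc rnorm (x + y) ^ p = (rnorm (x + y) ^ r) ^ (p / r) := by
            rw [← ENNReal.rpow_mul, mul_div_cancel₀ _ hr.ne']
        _ ≤ _ := ENNReal.rpow_le_rpow (rnorm_add_rpow_le_add r x y) (by positivity)
    refine key.trans ((ENNReal.rpow_add_le_add_rpow _ _ (by positivity)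
      ((div_le_one hr).2 h)).trans_eq ?_)
    rw [← ENNReal.rpow_mul, ← ENNReal.rpow_mul, mul_div_cancel₀ _ hr.ne']
  · rw [min_eq_left h]
    calc rnorm (x + y) ^ p = (rnorm (x + y) ^ r) ^ (p / r) := by
            rw [← ENNReal.rpow_mul, mul_div_cancel₀ _ hr.ne']
      _ ≤ (rnorm x ^ r + rnorm y ^ r) ^ (p / r) :=
          ENNReal.rpow_le_rpow (rnorm_add_rpow_le_add r x y) (by positivity)
      _ ≤ 2 ^ (p / r - 1) * ((rnorm x ^ r) ^ (p / r) + (rnorm y ^ r) ^ (p / r)) :=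
          ENNReal.rpow_add_le_mul_rpow_add_rpow _ _ ((one_le_div hr).2 h)
      _ = _ := by rw [← ENNReal.rpow_mul, ← ENNReal.rpow_mul, mul_div_cancel₀ _ hr.ne']

/-- This is where `2^(1/r - 1)` in the upper bound comes from: `2^(1/r)` is the quasi-triangle
constant in terms of the maximum, and homogeneity divides it by `2`. -/
theorem rnorm_le_max_of_two_smul (r : ℝ) [RNormedSpace r E] {x y z : E}
    (h : (2 : ℝ) • z = x + y) : rnorm z ≤ 2 ^ (1 / r - 1) * max (rnorm x) (rnorm y) := by
  have hr := RNormedSpace.r_pos (r := r) E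
  have h1 : rnorm (x + y) ^ r ≤ 2 * max (rnorm x) (rnorm y) ^ r := by
    refine (rnorm_add_rpow_le_add r x y).trans ?_
    rw [two_mul]
    gcongr
    exacts [le_max_left _ _, le_max_right _ _]
  have h2 : rnorm (x + y) ≤ 2 ^ (1 / r) * max (rnorm x) (rnorm y) := by
    have := ENNReal.rpow_le_rpow h1 (inv_nonneg.2 hr.le)
    rwa [ENNReal.rpow_rpow_inv hr.ne', ENNReal.mul_rpow_of_nonneg _ _ (inv_nonneg.2 hr.le),
      ENNReal.rpow_rpow_inv hr.ne', ← one_div] at this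
  rw [← h, rnorm_smul r] at h2
  have h2' : (2 : ℝ≥0∞) * rnorm z ≤ 2 ^ (1 / r) * max (rnorm x) (rnorm y) := by simpa using h2
  calc rnorm z = 2⁻¹ * (2 * rnorm z) := by
        rw [← mul_assoc, ENNReal.inv_mul_cancel (by norm_num) (by norm_num), one_mul]
    _ ≤ 2⁻¹ * (2 ^ (1 / r) * max (rnorm x) (rnorm y)) := by gcongr
    _ = _ := by
        rw [ENNReal.rpow_sub _ _ (by norm_num) (by norm_num), ENNReal.rpow_one, ← mul_assoc,
          ENNReal.div_eq_inv_mul]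

theorem RNormedSpace.dist_add_add_le (r : ℝ) [RNormedSpace r E] (x y x' y' : E) :
    dist (x + y) (x' + y') ≤ dist x x' + dist y y' := by
  simp only [RNormedSpace.dist_eq_rpow (r := r)]
  rw [add_sub_add_comm]
  exact RNormedSpace.rnorm_add_rpow_le _ _

theorem RNormedSpace.dist_neg_neg (r : ℝ) [RNormedSpace r E] (x y : E) :
    dist (-x) (-y) = dist x y := by
  simp only [RNormedSpace.dist_eq_rpow (r := r)]
  rw [show -x - -y = (-1 : ℝ) • (x - y) by rw [neg_one_smul]; abel, RNormedSpace.rnorm_smul r]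
  simp

theorem RNormedSpace.dist_smul_smul (r : ℝ) [RNormedSpace r E] (c : ℝ) (x y : E) :
    dist (c • x) (c • y) = |c| ^ r * dist x y := by
  simp only [RNormedSpace.dist_eq_rpow (r := r)]
  rw [← smul_sub, RNormedSpace.rnorm_smul r,
    Real.mul_rpow (abs_nonneg _) (RNormedSpace.rnorm_nonneg r _)]

theorem RNormedSpace.dist_smul_smul_right (r : ℝ) [RNormedSpace r E] (c d : ℝ) (x : E) :
    dist (c • x) (d • x) = |c - d| ^ r * dist x 0 := by
  simp only [RNormedSpace.dist_eq_rpow (r := r)]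
  rw [← sub_smul, RNormedSpace.rnorm_smul r, sub_zero,
    Real.mul_rpow (abs_nonneg _) (RNormedSpace.rnorm_nonneg r _)]

/-- The metric of `E` is tied to the `r`-norm only by an equation, so that continuity of the vector
space operations has to be deduced from the axioms. -/
theorem RNormedSpace.isTopologicalAddGroup (r : ℝ) [RNormedSpace r E] :
    IsTopologicalAddGroup E where
  continuous_add := by
    refine continuous_iff_continuousAt.2 fun ⟨a, b⟩ => tendsto_iff_dist_tendsto_zero.2 ?_
    have h : Tendsto (fun q : E × E => dist q.1 a + dist q.2 b) (𝓝 (a, b)) (𝓝 0) := by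
      have : Continuous fun q : E × E => dist q.1 a + dist q.2 b := by fun_prop
      simpa using this.tendsto (a, b)
    exact squeeze_zero (fun _ => dist_nonneg)
      (fun q => RNormedSpace.dist_add_add_le r q.1 q.2 a b) h
  continuous_neg := by
    refine (LipschitzWith.of_dist_le_mul (K := 1) fun x y => ?_).continuous
    rw [RNormedSpace.dist_neg_neg r]; simp

theorem RNormedSpace.continuousSMul (r : ℝ) [RNormedSpace r E] : ContinuousSMul ℝ E where
  continuous_smul := by
    have hr := RNormedSpace.r_pos (r := r) E
    refine continuous_iff_continuousAt.2 fun ⟨c, x⟩ => tendsto_iff_dist_tendsto_zero.2 ?_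
    have h : Tendsto (fun q : ℝ × E => |q.1| ^ r * dist q.2 x + |q.1 - c| ^ r * dist x 0)
        (𝓝 (c, x)) (𝓝 0) := by
      have : Continuous fun q : ℝ × E =>
          |q.1| ^ r * dist q.2 x + |q.1 - c| ^ r * dist x 0 := by
        have h1 : Continuous fun q : ℝ × E => |q.1| ^ r :=
          (continuous_fst.abs).rpow_const fun _ => Or.inr hr.le
        have h2 : Continuous fun q : ℝ × E => |q.1 - c| ^ r :=
          ((continuous_fst.sub continuous_const).abs).rpow_const fun _ => Or.inr hr.le
        fun_prop
      simpa [Real.zero_rpow hr.ne'] using this.tendsto (c, x)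
    refine squeeze_zero (fun _ => dist_nonneg) (fun q => ?_) h
    refine (dist_triangle _ (q.1 • x) _).trans ?_
    rw [RNormedSpace.dist_smul_smul r, RNormedSpace.dist_smul_smul_right r]

theorem continuous_rnorm (r : ℝ) [RNormedSpace r E] : Continuous (rnorm : E → ℝ≥0∞) := by
  have : (rnorm : E → ℝ≥0∞) = fun x => edist x 0 ^ (1 / r) :=
    funext fun x => rnorm_eq_edist_rpow r x
  rw [this]
  exact ENNReal.continuous_rpow_const.comp (continuous_id.edist continuous_const)

theorem measurable_rnorm (r : ℝ) [RNormedSpace r E] [MeasurableSpace E] [BorelSpace E] :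
    Measurable (rnorm : E → ℝ≥0∞) :=
  (continuous_rnorm r).measurable

theorem tendsto_iff_rnorm_sub (r : ℝ) [RNormedSpace r E] {ι : Type*} {l : Filter ι} {f : ι → E}
    {a : E} : Tendsto f l (𝓝 a) ↔ Tendsto (fun i => rnorm (f i - a)) l (𝓝 0) := by
  have hr := RNormedSpace.r_pos (r := r) E
  rw [tendsto_iff_edist_tendsto_0]
  constructor
  · intro h
    have := (ENNReal.continuous_rpow_const (y := 1 / r)).tendsto 0 |>.comp h
    rw [ENNReal.zero_rpow_of_pos (by positivity)] at this
    refine this.congr fun i => ?_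
    rw [Function.comp_apply, ← rnorm_rpow_eq_edist r, one_div, ENNReal.rpow_rpow_inv hr.ne']
  · intro h
    have := (ENNReal.continuous_rpow_const (y := r)).tendsto 0 |>.comp h
    rw [ENNReal.zero_rpow_of_pos hr] at this
    exact this.congr fun i => rnorm_rpow_eq_edist r _ _

/-- Makes the vector-valued maximal inequality available for the scalar processes `W (A t f)`. -/
instance instRNormedSpaceReal : RNormedSpace 1 ℝ where
  r_pos := one_pos
  r_le_one := le_rfl
  rnorm_nonneg := norm_nonneg
  rnorm_smul c x := by simp
  rnorm_eq_zero_iff x := norm_eq_zero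
  rnorm_add_rpow_le x y := by simpa using abs_add_le x y
  dist_eq_rpow x y := by simp [Real.dist_eq]

end RNorm

/-! ### Isonormal processes: linearity and joint laws -/

section Isonormal

theorem IsIsonormal.aemeasurable {Ω K : Type*} [MeasurableSpace Ω] {P : Measure Ω}
    (W : K → Lp ℝ 2 P) (a : K) : AEMeasurable (W a) P :=
  (Lp.aestronglyMeasurable _).aemeasurable

theorem IsIsonormal.aemeasurable_pi {Ω K : Type*} [MeasurableSpace Ω] {P : Measure Ω}
    (W : K → Lp ℝ 2 P) {ι : Type*} [Fintype ι] (a : ι → K) :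
    AEMeasurable (fun ω i => W (a i) ω) P :=
  aemeasurable_pi_lambda _ fun i => IsIsonormal.aemeasurable W (a i)

variable {Ω K : Type*} [MeasurableSpace Ω] {P : Measure Ω}
  [NormedAddCommGroup K] [InnerProductSpace ℝ K] {W : K → Lp ℝ 2 P}

theorem IsIsonormal.inner_eq (hW : IsIsonormal W) (a b : K) : inner ℝ (W a) (W b) = inner ℝ a b := by
  rw [L2.inner_def, ← hW.covariance]
  refine integral_congr_ae (Eventually.of_forall fun ω => ?_)
  simp [mul_comm]

/-- An isonormal process is a linear isometry. -/
noncomputable def IsIsonormal.toLinearMap (hW : IsIsonormal W) : K →ₗ[ℝ] Lp ℝ 2 P where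
  toFun := W
  map_add' a b := by
    -- The squared norm of the defect `W (a + b) - W a - W b` expands by the covariance identity
    -- into the same expression in `K`, which vanishes.
    rw [← sub_eq_zero, ← inner_self_eq_zero (𝕜 := ℝ)]
    simp only [inner_sub_left, inner_sub_right, inner_add_left, inner_add_right, hW.inner_eq]
    ring
  map_smul' c a := by
    rw [← sub_eq_zero, ← inner_self_eq_zero (𝕜 := ℝ)]
    simp only [inner_sub_left, inner_sub_right, inner_smul_left, inner_smul_right, hW.inner_eq,
      RingHom.id_apply, conj_trivial]
    ring

theorem IsIsonormal.ae_sum_smul (hW : IsIsonormal W) {ι : Type*} (s : Finset ι) (c : ι → ℝ)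
    (a : ι → K) : W (∑ i ∈ s, c i • a i) =ᵐ[P] fun ω => ∑ i ∈ s, c i * W (a i) ω := by
  have h : W (∑ i ∈ s, c i • a i) = ∑ i ∈ s, c i • W (a i) := by
    change hW.toLinearMap _ = ∑ i ∈ s, c i • hW.toLinearMap (a i)
    simp
  rw [h]
  refine (Lp.coeFn_finsetSum _ _).trans ?_
  have : ∀ᵐ ω ∂P, ∀ i ∈ s, (c i • W (a i) : Lp ℝ 2 P) ω = c i * W (a i) ω := by
    refine (ae_ball_iff s.countable_toSet).2 fun i _ => ?_
    filter_upwards [Lp.coeFn_smul (c i) (W (a i))] with ω hω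
    simpa using hω
  filter_upwards [this] with ω hω
  rw [Finset.sum_apply]
  exact Finset.sum_congr rfl hω

theorem IsIsonormal.map_eq (hW : IsIsonormal W) (a : K) :
    P.map (W a) = gaussianReal 0 (‖a‖₊ ^ 2) := by
  obtain ⟨v, hv⟩ := hW.gaussian a
  have h1 : ∫ x, x ^ 2 ∂(gaussianReal 0 v) = v := by
    have := variance_fun_id_gaussianReal (μ := 0) (v := v)
    rwa [variance_eq_integral (by fun_prop), integral_id_gaussianReal, funext fun x : ℝ =>
      congrArg (· ^ 2) (sub_zero x)] at this
  have h2 : ∫ x, x ^ 2 ∂(gaussianReal 0 v) = ‖a‖ ^ 2 := by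
    rw [← hv, integral_map (IsIsonormal.aemeasurable W a) (by fun_prop),
      ← real_inner_self_eq_norm_sq, ← hW.covariance]
    simp_rw [sq]
  rw [hv]
  congr 1
  ext
  push_cast
  rw [← h1, h2]

/-- By linearity every combination of the `W (a i)` is some `W f`, a centred Gaussian whose variance
is `‖f‖ ^ 2`. Thus joint Gaussianity, assumed only for single variables, comes for free. -/
theorem IsIsonormal.charFun_map (hW : IsIsonormal W) {ι : Type*} [Fintype ι] (a : ι → K)
    (t : EuclideanSpace ℝ ι) :
    charFun ((P.map fun ω i => W (a i) ω).map (WithLp.toLp 2)) t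
      = Complex.exp (-(‖∑ i, t i • a i‖ ^ 2 : ℝ) / 2) := by
  have hm : Measurable (WithLp.toLp 2 : (ι → ℝ) → EuclideanSpace ℝ ι) := by fun_prop
  rw [AEMeasurable.map_map_of_aemeasurable hm.aemeasurable (IsIsonormal.aemeasurable_pi W a)]
  have h1 := charFun_gaussianReal (μ := 0) (v := ‖∑ i, t i • a i‖₊ ^ 2) 1
  rw [← hW.map_eq, charFun_apply, integral_map (IsIsonormal.aemeasurable _ _)
    (by fun_prop)] at h1
  rw [charFun_apply, integral_map
    (hm.comp_aemeasurable (IsIsonormal.aemeasurable_pi W a)) (by fun_prop)]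
  have h2 : ∀ᵐ ω ∂P, Complex.exp
      (((inner ℝ ((WithLp.toLp 2 : (ι → ℝ) → EuclideanSpace ℝ ι) fun i => W (a i) ω) t : ℝ) : ℂ)
        * Complex.I) =
      Complex.exp (((inner ℝ (W (∑ i, t i • a i) ω) 1 : ℝ) : ℂ) * Complex.I) := by
    filter_upwards [hW.ae_sum_smul Finset.univ (fun i => t i) a] with ω hω
    rw [hω, PiLp.inner_apply]
    simp
  refine (integral_congr_ae h2).trans (h1.trans ?_)
  congr 1
  push_cast
  simp
  ring

/-- The joint law of finitely many variables of an isonormal process depends only on the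
covariances. -/
theorem IsIsonormal.map_pi_eq [IsProbabilityMeasure P] (hW : IsIsonormal W) {ι : Type*}
    [Fintype ι] {a b : ι → K}
    (h : ∀ i j, inner ℝ (a i) (a j) = inner ℝ (b i) (b j)) :
    (P.map fun ω i => W (a i) ω) = P.map fun ω i => W (b i) ω := by
  refine (MeasurableEquiv.toLp 2 (ι → ℝ)).map_measurableEquiv_injective
      <| Measure.ext_of_charFun <| funext fun t => ?_
  rw [MeasurableEquiv.coe_toLp, hW.charFun_map, hW.charFun_map]
  congr 4
  simp only [← real_inner_self_eq_norm_sq, sum_inner, inner_sum, inner_smul_left,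
    inner_smul_right, h]

theorem IsIsonormal.map_orthonormal [IsProbabilityMeasure P] (hW : IsIsonormal W) {ι : Type*}
    [Fintype ι] {a : ι → K}
    (h : Orthonormal ℝ a) :
    (P.map fun ω i => W (a i) ω) = Measure.pi fun _ : ι => gaussianReal 0 1 := by
  rw [← charFun_eq_pi_iff]
  intro t
  rw [hW.charFun_map]
  simp_rw [charFun_gaussianReal, ← Complex.exp_sum]
  congr 1
  rw [← real_inner_self_eq_norm_sq, h.inner_sum]
  push_cast
  simp [Finset.sum_div, Finset.sum_neg_distrib, sq, neg_div]

end Isonormal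

/-! ### The `γ^p`-norms: quasi-triangle inequality, isometries and projections -/

section GammaNorm

variable {K E : Type*} [NormedAddCommGroup K] [InnerProductSpace ℝ K]
  [AddCommGroup E] [Module ℝ E] [MetricSpace E] [Norm E]

/-- The moment `𝔼 ‖∑ γ_n x_n‖ ^ p` of a Gaussian sum. -/
noncomputable def gaussMoment {E : Type*} [AddCommGroup E] [Module ℝ E] [Norm E] (p : ℝ) {N : ℕ}
    (x : Fin N → E) : ℝ≥0∞ :=
  ∫⁻ g, rnorm (∑ n, g n • x n) ^ p ∂(Measure.pi fun _ : Fin N => gaussianReal 0 1)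

theorem gaussMoment_le {p : ℝ} (hp : 0 < p) (R : K →ₗ[ℝ] E) {N : ℕ} {h : Fin N → K}
    (hh : Orthonormal ℝ h) : gaussMoment p (fun n => R (h n)) ≤ gammaNorm p R ^ p := by
  have h1 : gaussMoment p (fun n => R (h n)) ^ (1 / p) ≤ gammaNorm p R :=
    le_iSup_of_le N (le_iSup_of_le h (le_iSup_of_le hh le_rfl))
  have := ENNReal.rpow_le_rpow h1 hp.le
  rwa [one_div, ENNReal.rpow_inv_rpow hp.ne'] at this

theorem gammaNorm_rpow_le {p : ℝ} (hp : 0 < p) {R : K →ₗ[ℝ] E} {C : ℝ≥0∞}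
    (H : ∀ (N : ℕ) (h : Fin N → K), Orthonormal ℝ h → gaussMoment p (fun n => R (h n)) ≤ C) :
    gammaNorm p R ^ p ≤ C := by
  have : gammaNorm p R ≤ C ^ (1 / p) :=
    iSup_le fun N => iSup_le fun h => iSup_le fun hh =>
      ENNReal.rpow_le_rpow (H N h hh) (by positivity)
  have := ENNReal.rpow_le_rpow this hp.le
  rwa [one_div, ENNReal.rpow_inv_rpow hp.ne'] at this

theorem gammaNorm_le_of_rpow_le {p : ℝ} (hp : 0 < p) {R : K →ₗ[ℝ] E} {C : ℝ≥0∞}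
    (h : gammaNorm p R ^ p ≤ C ^ p) : gammaNorm p R ≤ C :=
  (ENNReal.rpow_le_rpow_iff hp).1 h

/-- An isometry carries orthonormal systems to orthonormal systems, so the supremum on the left runs
over fewer terms. -/
theorem gammaNorm_comp_isometry_le {p : ℝ} (hp : 0 < p) (R : K →ₗ[ℝ] E) {U : K →ₗ[ℝ] K}
    (hU : ∀ f g, inner ℝ (U f) (U g) = inner ℝ f g) :
    gammaNorm p (R ∘ₗ U) ^ p ≤ gammaNorm p R ^ p := by
  refine gammaNorm_rpow_le hp fun N h hh => ?_
  refine gaussMoment_le hp R (h := fun n => U (h n)) ?_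
  rw [orthonormal_iff_ite] at hh ⊢
  simpa only [hU] using hh

variable [MeasurableSpace E] [BorelSpace E] [IsTopologicalAddGroup E] [ContinuousSMul ℝ E]

theorem measurable_rnorm_gaussSum (r : ℝ) [RNormedSpace r E] {ι : Type*} [Fintype ι] (x : ι → E) :
    Measurable fun g : ι → ℝ => rnorm (∑ n, g n • x n) :=
  ((continuous_rnorm r).comp (by fun_prop)).measurable

theorem gaussMoment_add_le (r : ℝ) [RNormedSpace r E] {p : ℝ} (hp : 0 < p) {N : ℕ}
    (x y : Fin N → E) :
    gaussMoment p (fun n => x n + y n) ≤ quasiConst r p * (gaussMoment p x + gaussMoment p y) := by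
  rw [gaussMoment, gaussMoment, gaussMoment, ← lintegral_add_left
    ((measurable_rnorm_gaussSum r x).pow_const p), ← lintegral_const_mul']
  · refine lintegral_mono fun g => ?_
    simp only [smul_add, Finset.sum_add_distrib]
    exact rnorm_add_rpow_le r hp _ _
  · exact quasiConst_ne_top r p

theorem gaussMoment_smul (r : ℝ) [RNormedSpace r E] {p : ℝ} (hp : 0 < p) {N : ℕ} (c : ℝ)
    (x : Fin N → E) :
    gaussMoment p (fun n => c • x n) = ENNReal.ofReal |c| ^ p * gaussMoment p x := by
  rw [gaussMoment, gaussMoment, ← lintegral_const_mul']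
  · refine lintegral_congr fun g => ?_
    simp only [smul_comm _ c, ← Finset.smul_sum]
    rw [rnorm_smul r, ENNReal.mul_rpow_of_nonneg _ _ hp.le]
  · exact ENNReal.rpow_ne_top_of_nonneg hp.le ENNReal.ofReal_ne_top

theorem gammaNorm_add_rpow_le (r : ℝ) [RNormedSpace r E] {p : ℝ} (hp : 0 < p) (R S : K →ₗ[ℝ] E) :
    gammaNorm p (R + S) ^ p ≤ quasiConst r p * (gammaNorm p R ^ p + gammaNorm p S ^ p) := by
  refine gammaNorm_rpow_le hp fun N h hh => ?_
  refine (gaussMoment_add_le r hp (fun n => R (h n)) (fun n => S (h n))).trans ?_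
  gcongr
  exacts [gaussMoment_le hp R hh, gaussMoment_le hp S hh]

theorem gammaNorm_smul_rpow_le (r : ℝ) [RNormedSpace r E] {p : ℝ} (hp : 0 < p) (c : ℝ)
    (R : K →ₗ[ℝ] E) : gammaNorm p (c • R) ^ p ≤ ENNReal.ofReal |c| ^ p * gammaNorm p R ^ p := by
  refine gammaNorm_rpow_le hp fun N h hh => ?_
  refine (gaussMoment_smul r hp c (fun n => R (h n))).trans_le ?_
  gcongr
  exact gaussMoment_le hp R hh

theorem gammaNorm_neg_rpow_le (r : ℝ) [RNormedSpace r E] {p : ℝ} (hp : 0 < p)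
    (R : K →ₗ[ℝ] E) : gammaNorm p (-R) ^ p ≤ gammaNorm p R ^ p := by
  rw [← neg_one_smul ℝ R]
  simpa using gammaNorm_smul_rpow_le r hp (-1) R

theorem gammaNorm_sub_rpow_le (r : ℝ) [RNormedSpace r E] {p : ℝ} (hp : 0 < p) (R S : K →ₗ[ℝ] E) :
    gammaNorm p (R - S) ^ p ≤ quasiConst r p * (gammaNorm p R ^ p + gammaNorm p S ^ p) := by
  rw [sub_eq_add_neg]
  refine (gammaNorm_add_rpow_le r hp R (-S)).trans ?_
  gcongr _ * (_ + ?_)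
  exact gammaNorm_neg_rpow_le r hp S

/-- The reflection `2 A - 1` in the range of a projection `A`. -/
def reflectionOf (A : K →ₗ[ℝ] K) : K →ₗ[ℝ] K := (2 : ℝ) • A - LinearMap.id

theorem reflectionOf_apply (A : K →ₗ[ℝ] K) (f : K) : reflectionOf A f = (2 : ℝ) • A f - f := rfl

/-- The symmetry behind both the maximal inequality and the lower bound. -/
theorem inner_reflectionOf {A : K →ₗ[ℝ] K} (hA : A.IsSymmetricProjection) (f g : K) :
    inner ℝ (reflectionOf A f) (reflectionOf A g) = inner ℝ f g := by
  have h1 : inner ℝ (A f) (A g) = inner ℝ f (A g) := by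
    rw [hA.isSymmetric]
    congr 1
    exact LinearMap.congr_fun hA.isIdempotentElem g
  have h2 : inner ℝ (A f) g = inner ℝ f (A g) := hA.isSymmetric f g
  simp only [reflectionOf_apply, inner_sub_left, inner_sub_right, inner_smul_left,
    inner_smul_right, h1, h2, conj_trivial]
  ring

/-- Composition with a symmetric projection is bounded for the `γ`-norms. -/
theorem gammaNorm_comp_projection_le (r : ℝ) [RNormedSpace r E] {p : ℝ} (hp : 0 < p)
    (R : K →ₗ[ℝ] E) {A : K →ₗ[ℝ] K} (hA : A.IsSymmetricProjection) :
    gammaNorm p (R ∘ₗ A) ^ p ≤ quasiConst r p * 2 * gammaNorm p R ^ p := by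
  -- A projection is the average of the identity and its reflection.
  have h1 : R ∘ₗ A = (1 / 2 : ℝ) • (R + R ∘ₗ reflectionOf A) := by
    ext f
    simp only [LinearMap.comp_apply, LinearMap.smul_apply, LinearMap.add_apply,
      reflectionOf_apply, map_sub, map_smul, add_sub_cancel, smul_smul]
    norm_num
  rw [h1]
  refine (gammaNorm_smul_rpow_le r hp _ _).trans ?_
  calc ENNReal.ofReal |(1 / 2 : ℝ)| ^ p * gammaNorm p (R + R ∘ₗ reflectionOf A) ^ p
      ≤ 1 * (quasiConst r p * (gammaNorm p R ^ p + gammaNorm p R ^ p)) := by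
        gcongr
        · refine ENNReal.rpow_le_one ?_ hp.le
          rw [ENNReal.ofReal_le_one]; norm_num [abs_of_pos]
        · refine (gammaNorm_add_rpow_le r hp _ _).trans ?_
          gcongr _ * (_ + ?_)
          exact gammaNorm_comp_isometry_le hp R (inner_reflectionOf hA)
    _ = _ := by rw [← two_mul, one_mul, mul_assoc]

end GammaNorm

/-! ### Fernique's argument: finiteness of all Gaussian moments -/

section Fernique

variable {E : Type*} [AddCommGroup E] [Module ℝ E] [MetricSpace E] [Norm E]

theorem isGaussian_pi_gaussianReal (N : ℕ) :
    IsGaussian (Measure.pi fun _ : Fin N => gaussianReal 0 1) := by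
  have h : (Measure.pi fun _ : Fin N => gaussianReal 0 1) =
      (stdGaussian (EuclideanSpace ℝ (Fin N))).map
        (EuclideanSpace.equiv (Fin N) ℝ : EuclideanSpace ℝ (Fin N) ≃L[ℝ] (Fin N → ℝ)) := by
    rw [← map_pi_eq_stdGaussian, Measure.map_map (by fun_prop) (by fun_prop)]
    exact Measure.map_id.symm
  rw [h]
  infer_instance

theorem map_rotation_pi_gaussianReal (N : ℕ) (θ : ℝ) :
    ((Measure.pi fun _ : Fin N => gaussianReal 0 1).prod
      (Measure.pi fun _ : Fin N => gaussianReal 0 1)).map (ContinuousLinearMap.rotation θ) =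
    (Measure.pi fun _ : Fin N => gaussianReal 0 1).prod
      (Measure.pi fun _ : Fin N => gaussianReal 0 1) := by
  have := isGaussian_pi_gaussianReal N
  refine IsGaussian.map_rotation_eq_self ?_ θ
  ext i
  rw [eval_integral]
  · simp only [id]
    exact (integral_comp_eval (μ := fun _ : Fin N => gaussianReal 0 1) (i := i) (f := id)
      (by fun_prop)).trans (by simp)
  · intro i
    exact integrable_comp_eval (μ := fun _ : Fin N => gaussianReal 0 1) (i := i) (f := id)
      ((memLp_id_gaussianReal (μ := 0) (v := 1) 1).integrable (by simp))

variable [MeasurableSpace E] [BorelSpace E] [IsTopologicalAddGroup E] [ContinuousSMul ℝ E]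

/-- With `c = √2 / 2` one has `c x + c y = √2 x - (c x - c y)`. If the `r`-norm of `x` were at most
`u`, that of the left side to the power `r` would be at most `2 u^r + u^r`; this is the origin of
the factor `3`. -/
theorem lt_rnorm_of_rotation (r : ℝ) [RNormedSpace r E] {x y : E} {s t u : ℝ≥0∞} (hsu : s ≤ u)
    (hut : 3 * u ^ r ≤ t ^ r) {c : ℝ} (hc : c = √2 / 2) (h1 : rnorm (c • x - c • y) ≤ s)
    (h2 : t < rnorm (c • x + c • y)) : u < rnorm x := by
  have hr := RNormedSpace.r_pos (r := r) E
  by_contra! h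
  have h3 : c • x + c • y = (2 * c) • x + -(c • x - c • y) := by
    rw [two_mul, add_smul]; abel
  have h4 := rnorm_add_rpow_le_add r ((2 * c) • x) (-(c • x - c • y))
  rw [← h3, rnorm_neg r, rnorm_smul r] at h4
  have hc2 : ENNReal.ofReal |2 * c| ^ r ≤ 2 := by
    have : 2 * c = √2 := by rw [hc]; ring
    rw [this, abs_of_nonneg (Real.sqrt_nonneg _)]
    calc ENNReal.ofReal √2 ^ r ≤ (2 : ℝ≥0∞) ^ r := by
          gcongr
          rw [ENNReal.ofReal_le_iff_le_toReal (by simp)]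
          simp
      _ ≤ 2 ^ (1 : ℝ) := ENNReal.rpow_le_rpow_of_exponent_le (by norm_num)
          (RNormedSpace.r_le_one E)
      _ = 2 := by simp
  have h5 : rnorm (c • x + c • y) ^ r ≤ t ^ r := by
    calc _ ≤ (ENNReal.ofReal |2 * c| * rnorm x) ^ r + rnorm (c • x - c • y) ^ r := h4
      _ ≤ 2 * u ^ r + u ^ r := by
          rw [ENNReal.mul_rpow_of_nonneg _ _ hr.le]
          gcongr
          exact h1.trans hsu
      _ = 3 * u ^ r := by ring
      _ ≤ _ := hut
  exact absurd ((ENNReal.rpow_le_rpow_iff hr).1 h5) (not_le.2 h2)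

/-- The left side is the probability of a product event for two independent copies. After a rotation
by `π / 4`, which preserves the product law, that event forces both copies above `u`. -/
theorem gaussSum_measure_mul_le (r : ℝ) [RNormedSpace r E] {N : ℕ} (x : Fin N → E)
    {s t u : ℝ≥0∞} (hsu : s ≤ u) (hut : 3 * u ^ r ≤ t ^ r) :
    (Measure.pi fun _ : Fin N => gaussianReal 0 1) {g | rnorm (∑ n, g n • x n) ≤ s} *
      (Measure.pi fun _ : Fin N => gaussianReal 0 1) {g | t < rnorm (∑ n, g n • x n)} ≤
    (Measure.pi fun _ : Fin N => gaussianReal 0 1) {g | u < rnorm (∑ n, g n • x n)} ^ 2 := by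
  set μ := Measure.pi fun _ : Fin N => gaussianReal 0 1 with hμ
  have hm := measurable_rnorm_gaussSum r x
  have hs : MeasurableSet {g : Fin N → ℝ | rnorm (∑ n, g n • x n) ≤ s} :=
    measurableSet_le hm measurable_const
  have ht : MeasurableSet {g : Fin N → ℝ | t < rnorm (∑ n, g n • x n)} :=
    measurableSet_lt measurable_const hm
  rw [← Measure.prod_prod, ← map_rotation_pi_gaussianReal N (-(Real.pi / 4)),
    Measure.map_apply (by fun_prop) (hs.prod ht), sq, ← Measure.prod_prod]
  refine measure_mono ?_
  rintro ⟨a, b⟩ ⟨h1, h2⟩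
  simp only [Set.mem_ofPred_eq, ContinuousLinearMap.rotation_apply, Real.cos_neg,
      Real.cos_pi_div_four, Real.sin_neg, Real.sin_pi_div_four, neg_smul, neg_neg, Pi.add_apply,
      Pi.smul_apply, ← sub_eq_add_neg, Pi.sub_apply, sub_smul, add_smul,
      Finset.sum_add_distrib, Finset.sum_sub_distrib, smul_assoc, ← Finset.smul_sum] at h1 h2
  refine ⟨lt_rnorm_of_rotation r hsu hut rfl h1 h2, ?_⟩
  rw [rnorm_sub_comm r] at h1
  rw [add_comm] at h2
  exact lt_rnorm_of_rotation r hsu hut rfl h1 h2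

/-- The constant in the moment comparison for Gaussian sums. -/
noncomputable def momentConst (r p : ℝ) : ℝ≥0∞ :=
  1 + ∑' n : ℕ, ((3 ^ (1 / r)) ^ p) ^ (n + 1) * (1 / 2) ^ 2 ^ n

theorem momentConst_ne_top {r p : ℝ} (hr : 0 < r) (hp : 0 < p) : momentConst r p ≠ ∞ := by
  rw [momentConst]
  refine ENNReal.add_ne_top.2 ⟨ENNReal.one_ne_top, ?_⟩
  set c : ℝ := (3 ^ (1 / r)) ^ p with hc
  have hc0 : 0 < c := by positivity
  have hcE : ((3 : ℝ≥0∞) ^ (1 / r)) ^ p = ENNReal.ofReal c := by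
    rw [hc, ← ENNReal.ofReal_rpow_of_nonneg (by positivity) hp.le,
      ← ENNReal.ofReal_rpow_of_nonneg (by positivity) (by positivity)]
    simp
  -- The doubly exponential decay beats every geometric growth: the ratio of consecutive terms is `c
  -- (1/2)^(2^n)`.
  have hs : Summable fun n : ℕ => c ^ (n + 1) * (1 / 2 : ℝ) ^ 2 ^ n := by
    refine summable_of_ratio_test_tendsto_lt_one (l := 0) one_pos
      (Eventually.of_forall fun n => by positivity) ?_
    have h1 : Tendsto (fun n : ℕ => c * (1 / 2 : ℝ) ^ 2 ^ n) atTop (𝓝 (c * 0)) := by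
      refine Tendsto.const_mul c ((tendsto_pow_atTop_nhds_zero_of_lt_one (by norm_num)
        (by norm_num)).comp (tendsto_pow_atTop_atTop_of_one_lt one_lt_two))
    rw [mul_zero] at h1
    refine h1.congr fun n => ?_
    rw [Real.norm_of_nonneg (by positivity), Real.norm_of_nonneg (by positivity),
      eq_div_iff (by positivity), pow_succ 2 n, pow_mul]
    ring
  convert hs.tsum_ofReal_ne_top using 3 with n
  rw [hcE, ENNReal.ofReal_mul (by positivity), ENNReal.ofReal_pow hc0.le,
    ENNReal.ofReal_pow (by norm_num), ENNReal.ofReal_div_of_pos (by norm_num)]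
  simp

/-- Fernique's argument: all moments of a Gaussian sum are controlled by a quantile. -/
theorem gaussMoment_le_of_measure_le (r : ℝ) [RNormedSpace r E] {p : ℝ} (hp : 0 < p) {N : ℕ}
    (x : Fin N → E) {s : ℝ≥0∞} (hs0 : s ≠ 0)
    (hs : (Measure.pi fun _ : Fin N => gaussianReal 0 1) {g | s < rnorm (∑ n, g n • x n)} ≤ 1 / 4) :
    gaussMoment p x ≤ momentConst r p * s ^ p := by
  have hr := RNormedSpace.r_pos (r := r) E
  set μ := Measure.pi fun _ : Fin N => gaussianReal 0 1 with hμ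
  have hm := measurable_rnorm_gaussSum r x
  set b : ℝ≥0∞ := 3 ^ (1 / r) with hb
  have hb1 : 1 < b := ENNReal.one_lt_rpow (by norm_num) (by positivity)
  have hbr : b ^ r = 3 := by rw [hb, one_div, ENNReal.rpow_inv_rpow hr.ne']
  have hmt (n : ℕ) : MeasurableSet {g : Fin N → ℝ | b ^ n * s < rnorm (∑ n, g n • x n)} :=
    measurableSet_lt measurable_const hm
  have hhalf : (1 / 2 : ℝ≥0∞) ≤ μ {g | rnorm (∑ n, g n • x n) ≤ s} := by
    have h1 : {g : Fin N → ℝ | rnorm (∑ n, g n • x n) ≤ s} =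
        {g | s < rnorm (∑ n, g n • x n)}ᶜ := by ext g; simp
    rw [h1, prob_compl_eq_one_sub (measurableSet_lt measurable_const hm)]
    refine le_trans ?_ (tsub_le_tsub_left hs 1)
    rw [ENNReal.le_sub_iff_add_le_right (by norm_num)]
    · rw [← ENNReal.toReal_le_toReal (by norm_num) (by norm_num)]
      rw [ENNReal.toReal_add (by norm_num) (by norm_num)]
      norm_num
    · rw [ENNReal.div_le_iff (by norm_num) (by norm_num)]; norm_num
  -- With levels growing by the factor `b = 3^(1/r)`, the tails satisfy `p_(n+1) ≤ 2 p_n^2` and `p_0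
  -- ≤ 1/4`; hence `2 p_n` is squared at each step, starting from at most `1/2`.
  have hdecay (n : ℕ) : μ {g | b ^ n * s < rnorm (∑ n, g n • x n)} ≤
      1 / 2 * (1 / 2) ^ 2 ^ n := by
    induction n with
    | zero =>
      simp only [pow_zero, one_mul, pow_one]
      refine hs.trans_eq ?_
      rw [← ENNReal.toReal_eq_toReal_iff' (by norm_num)
        (ENNReal.mul_ne_top (by norm_num) (by norm_num))]
      norm_num
    | succ n ih =>
      have h1 := gaussSum_measure_mul_le r x (s := s) (u := b ^ n * s) (t := b ^ (n + 1) * s)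
        (le_mul_of_one_le_left' (one_le_pow₀ hb1.le)) (le_of_eq (by
          rw [ENNReal.mul_rpow_of_nonneg _ _ hr.le, ENNReal.mul_rpow_of_nonneg _ _ hr.le,
            pow_succ, ENNReal.mul_rpow_of_nonneg _ _ hr.le, hbr]; ring))
      have h2 : 1 / 2 * μ {g | b ^ (n + 1) * s < rnorm (∑ n, g n • x n)} ≤
          (1 / 2 * (1 / 2) ^ 2 ^ n) ^ 2 :=
        (mul_le_mul_left hhalf _).trans (h1.trans (by gcongr))
      have h3 : 2 * (1 / 2 * μ {g | b ^ (n + 1) * s < rnorm (∑ n, g n • x n)}) ≤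
          2 * (1 / 2 * (1 / 2) ^ 2 ^ n) ^ 2 := by gcongr
      have h4 : (2 : ℝ≥0∞) * (1 / 2) = 1 := by
        rw [one_div]; exact ENNReal.mul_inv_cancel (by norm_num) (by norm_num)
      rw [← mul_assoc, h4, one_mul] at h3
      refine h3.trans_eq ?_
      rw [mul_pow, sq (1 / 2 : ℝ≥0∞), ← mul_assoc, ← mul_assoc, h4, one_mul, pow_succ 2 n, pow_mul]
  -- Above the level `s`, the first `n` with the value at most `b^(n+1) s` also has it above `b^n
  -- s`, so the `n`-th term of the series alone dominates.
  have hpt (g : Fin N → ℝ) : rnorm (∑ n, g n • x n) ^ p ≤ s ^ p + ∑' n : ℕ,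
      {g : Fin N → ℝ | b ^ n * s < rnorm (∑ n, g n • x n)}.indicator
        (fun _ => (b ^ (n + 1) * s) ^ p) g := by
    by_cases hle : rnorm (∑ n, g n • x n) ≤ s
    · exact (ENNReal.rpow_le_rpow hle hp.le).trans le_self_add
    · have hex : ∃ n : ℕ, rnorm (∑ n, g n • x n) ≤ b ^ (n + 1) * s := by
        have h1 : Tendsto (fun n : ℕ => b ^ (n + 1) * s) atTop (𝓝 ∞) := by
          have := (ENNReal.tendsto_pow_atTop_nhds_top_iff.2 hb1).comp (tendsto_add_atTop_nat 1)
          simpa [ENNReal.top_mul hs0] using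
            ENNReal.Tendsto.mul_const this (Or.inl ENNReal.top_ne_zero) (b := s)
        exact ((tendsto_order.1 h1).1 _ (lt_top_iff_ne_top.2 (rnorm_ne_top _))).exists.imp
          fun _ h => h.le
      classical
      have hlt : b ^ (Nat.find hex) * s < rnorm (∑ n, g n • x n) := by
        rcases Nat.eq_zero_or_pos (Nat.find hex) with h0 | h0
        · rw [h0, pow_zero, one_mul]; exact not_le.1 hle
        · have := Nat.find_min hex (Nat.sub_lt h0 one_pos)
          rwa [show Nat.find hex - 1 + 1 = Nat.find hex by omega, not_le] at this
      refine le_trans ?_ le_add_self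
      refine le_trans ?_ (ENNReal.le_tsum (Nat.find hex))
      rw [Set.indicator_of_mem (by exact hlt)]
      exact ENNReal.rpow_le_rpow (Nat.find_spec hex) hp.le
  calc gaussMoment p x ≤ ∫⁻ g, (s ^ p + ∑' n : ℕ,
      {g : Fin N → ℝ | b ^ n * s < rnorm (∑ n, g n • x n)}.indicator
        (fun _ => (b ^ (n + 1) * s) ^ p) g) ∂μ := lintegral_mono hpt
    _ = s ^ p + ∑' n : ℕ, (b ^ (n + 1) * s) ^ p *
        μ {g | b ^ n * s < rnorm (∑ n, g n • x n)} := by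
      rw [lintegral_add_left measurable_const, lintegral_const, measure_univ, mul_one,
        lintegral_tsum fun n => (measurable_const.indicator (hmt n)).aemeasurable]
      congr 2
      ext n
      rw [lintegral_indicator_const (hmt n)]
    _ ≤ s ^ p + ∑' n : ℕ, ((b ^ p) ^ (n + 1) * (1 / 2) ^ 2 ^ n) * s ^ p := by
      refine add_le_add le_rfl (ENNReal.tsum_le_tsum fun n => ?_)
      rw [ENNReal.mul_rpow_of_nonneg _ _ hp.le]
      have e1 : (b ^ (n + 1)) ^ p = (b ^ p) ^ (n + 1) := by
        rw [← ENNReal.rpow_natCast, ← ENNReal.rpow_natCast, ← ENNReal.rpow_mul b,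
          ← ENNReal.rpow_mul b, mul_comm]
      rw [e1, mul_right_comm]
      gcongr ?_ * _
      gcongr
      refine (hdecay n).trans (mul_le_of_le_one_left' ?_)
      rw [ENNReal.div_le_iff (by norm_num) (by norm_num)]; norm_num
    _ = momentConst r p * s ^ p := by
      rw [ENNReal.tsum_mul_right, momentConst, add_mul, one_mul]

/-- The Kahane-Khintchine inequality, in qualitative form: a `γ`-summing operator has finite
`γ^p`-norm for every `p`. -/
theorem gammaNorm_lt_top (r : ℝ) [RNormedSpace r E] {K : Type*} [NormedAddCommGroup K]
    [InnerProductSpace ℝ K] {R : K →ₗ[ℝ] E} (hR : gammaNorm 2 R < ∞) {p : ℝ} (hp : 0 < p) :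
    gammaNorm p R < ∞ := by
  have hr := RNormedSpace.r_pos (r := r) E
  -- Twice the `γ^2`-norm makes Chebyshev's bound `1/4`, uniformly over orthonormal systems; the
  -- added `1` keeps the level nonzero when the norm is zero.
  set s : ℝ≥0∞ := 2 * gammaNorm 2 R + 1 with hs
  have hs0 : s ≠ 0 := by simp [hs]
  have hst : s ≠ ∞ := by simp [hs, ENNReal.mul_eq_top, hR.ne]
  have h1 : gammaNorm p R ^ p ≤ momentConst r p * s ^ p := by
    refine gammaNorm_rpow_le hp fun N h hh => gaussMoment_le_of_measure_le r hp _ hs0 ?_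
    have h2 := mul_meas_ge_le_lintegral
      (μ := Measure.pi fun _ : Fin N => gaussianReal 0 1)
      ((measurable_rnorm_gaussSum r fun n => R (h n)).pow_const (2 : ℝ)) (s ^ (2 : ℝ))
    have h3 : (Measure.pi fun _ : Fin N => gaussianReal 0 1)
        {g | s < rnorm (∑ n, g n • R (h n))} ≤ (Measure.pi fun _ : Fin N => gaussianReal 0 1)
        {g | s ^ (2 : ℝ) ≤ rnorm (∑ n, g n • R (h n)) ^ (2 : ℝ)} :=
      measure_mono fun g hg => ENNReal.rpow_le_rpow (le_of_lt hg) (by norm_num)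
    have h4 : s ^ (2 : ℝ) * (Measure.pi fun _ : Fin N => gaussianReal 0 1)
        {g | s < rnorm (∑ n, g n • R (h n))} ≤ s ^ (2 : ℝ) * (1 / 4) := by
      calc _ ≤ gaussMoment 2 (fun n => R (h n)) := (mul_le_mul_right h3 _).trans h2
        _ ≤ gammaNorm 2 R ^ (2 : ℝ) := gaussMoment_le two_pos R hh
        _ = (2 * gammaNorm 2 R) ^ (2 : ℝ) * (1 / 4) := by
            rw [ENNReal.mul_rpow_of_nonneg _ _ (by norm_num), mul_right_comm]
            rw [show (2 : ℝ≥0∞) ^ (2 : ℝ) * (1 / 4) = 1 from ?_, one_mul]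
            rw [ENNReal.rpow_ofNat, one_div, show (2 : ℝ≥0∞) ^ 2 = 4 by norm_num,
              ENNReal.mul_inv_cancel (by norm_num) (by norm_num)]
        _ ≤ s ^ (2 : ℝ) * (1 / 4) := by gcongr; exact le_self_add
    refine (ENNReal.mul_le_mul_iff_right ?_ ?_).1 h4
    · exact (ENNReal.rpow_pos (pos_iff_ne_zero.2 hs0) hst).ne'
    · exact ENNReal.rpow_ne_top_of_nonneg (by norm_num) hst
  have h5 : gammaNorm p R ^ p < ∞ := h1.trans_lt (ENNReal.mul_lt_top
    (momentConst_ne_top hr hp).lt_top (ENNReal.rpow_lt_top_of_nonneg hp.le hst))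
  exact (ENNReal.rpow_lt_top_iff_of_pos hp).1 h5

end Fernique

/-! ### Algebra of finite rank operators and their integrals -/

section FiniteRank

variable {Ω K E : Type*} [MeasurableSpace Ω] {P : Measure Ω}
  [NormedAddCommGroup K] [InnerProductSpace ℝ K]
  [AddCommGroup E] [Module ℝ E] [Norm E]

theorem finiteRankOp_apply {N : ℕ} (h : Fin N → K) (x : Fin N → E) (f : K) :
    finiteRankOp h x f = ∑ n, (inner ℝ (h n) f : ℝ) • x n := by
  simp [finiteRankOp]

theorem finiteRankOp_apply_self {N : ℕ} {h : Fin N → K} (hh : Orthonormal ℝ h) (x : Fin N → E)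
    (m : Fin N) : finiteRankOp h x (h m) = x m := by
  classical
  rw [finiteRankOp_apply]
  simp [orthonormal_iff_ite.1 hh, ite_smul]

/-- Concatenation represents differences by a single family, at the price of orthonormality;
`IsIsonormal.exists_orthonormal` restores it. -/
theorem finiteRankOp_append_neg {M N : ℕ} (h : Fin M → K) (x : Fin M → E) (h' : Fin N → K)
    (x' : Fin N → E) :
    finiteRankOp (Fin.append h h') (Fin.append x (-x')) = finiteRankOp h x - finiteRankOp h' x' := by
  ext f
  simp [finiteRankOp_apply, Fin.sum_univ_add, sub_eq_add_neg]

theorem finiteRankIntegral_append_neg (W : K → Lp ℝ 2 P) {M N : ℕ} (h : Fin M → K) (x : Fin M → E)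
    (h' : Fin N → K) (x' : Fin N → E) (ω : Ω) :
    finiteRankIntegral W (Fin.append h h') (Fin.append x (-x')) ω =
      finiteRankIntegral W h x ω - finiteRankIntegral W h' x' ω := by
  simp [finiteRankIntegral, Fin.sum_univ_add, sub_eq_add_neg]

theorem finiteRankOp_comp {N : ℕ} (h : Fin N → K) (x : Fin N → E) {A : K →ₗ[ℝ] K}
    (hA : A.IsSymmetric) : finiteRankOp h x ∘ₗ A = finiteRankOp (fun n => A (h n)) x := by
  ext f
  simp only [LinearMap.comp_apply, finiteRankOp_apply]
  exact Finset.sum_congr rfl fun n _ => by rw [hA]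

theorem comp_finiteRankOp {N : ℕ} (h : Fin N → K) (R : K →ₗ[ℝ] E) :
    R ∘ₗ finiteRankOp h h = finiteRankOp h fun n => R (h n) := by
  ext f
  simp [finiteRankOp_apply]

theorem isSymmetricProjection_finiteRankOp {N : ℕ} {h : Fin N → K} (hh : Orthonormal ℝ h) :
    (finiteRankOp h h).IsSymmetricProjection where
  isIdempotentElem := by
    ext f
    rw [Module.End.mul_apply, finiteRankOp_apply h h f, map_sum]
    simp [finiteRankOp_apply_self hh]
  isSymmetric f g := by
    simp only [finiteRankOp_apply, sum_inner, inner_sum, inner_smul_left, inner_smul_right,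
      conj_trivial]
    exact Finset.sum_congr rfl fun n _ => by rw [real_inner_comm f, mul_comm]

theorem finiteRankOp_comp_projection {N : ℕ} {h : Fin N → K} (hh : Orthonormal ℝ h)
    (x : Fin N → E) : finiteRankOp h x ∘ₗ finiteRankOp h h = finiteRankOp h x := by
  rw [finiteRankOp_comp h x (isSymmetricProjection_finiteRankOp hh).isSymmetric]
  congr 1
  exact funext fun n => finiteRankOp_apply_self hh h n

/-- A finite rank operator and its stochastic integral can be represented by an orthonormal
family. -/
theorem IsIsonormal.exists_orthonormal {W : K → Lp ℝ 2 P} (hW : IsIsonormal W) {N : ℕ}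
    (h : Fin N → K) (x : Fin N → E) :
    ∃ (M : ℕ) (e : Fin M → K) (y : Fin M → E), Orthonormal ℝ e ∧
      finiteRankOp e y = finiteRankOp h x ∧
      finiteRankIntegral W e y =ᵐ[P] finiteRankIntegral W h x := by
  classical
  set V := Submodule.span ℝ (Set.range h)
  have hfin : FiniteDimensional ℝ V := FiniteDimensional.span_of_finite ℝ (Set.finite_range h)
  let b := stdOrthonormalBasis ℝ V
  let e : Fin (Module.finrank ℝ V) → K := fun m => b m
  have he : Orthonormal ℝ e := b.orthonormal.comp_linearIsometry V.subtypeₗᵢ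
  have hexp (n : Fin N) : h n = ∑ m, (inner ℝ (e m) (h n) : ℝ) • e m := by
    have := congrArg (fun v : V => (v : K))
      (b.sum_repr' ⟨h n, Submodule.subset_span (Set.mem_range_self n)⟩)
    simpa using this.symm
  refine ⟨_, e, fun m => ∑ n, (inner ℝ (e m) (h n) : ℝ) • x n, he, ?_, ?_⟩
  · ext f
    simp only [finiteRankOp_apply, Finset.smul_sum, smul_smul]
    rw [Finset.sum_comm]
    refine Finset.sum_congr rfl fun n _ => ?_
    rw [← Finset.sum_smul]
    congr 1
    conv_rhs => rw [hexp n, sum_inner]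
    refine Finset.sum_congr rfl fun m _ => ?_
    rw [inner_smul_left, mul_comm, conj_trivial]
  · have h1 : ∀ᵐ ω ∂P, ∀ n, W (h n) ω = ∑ m, inner ℝ (e m) (h n) * W (e m) ω := by
      rw [ae_all_iff]
      intro n
      have := hW.ae_sum_smul Finset.univ (fun m => inner ℝ (e m) (h n)) e
      rwa [← hexp n] at this
    filter_upwards [h1] with ω hω
    simp only [finiteRankIntegral, Finset.smul_sum, smul_smul]
    rw [Finset.sum_comm]
    refine Finset.sum_congr rfl fun n _ => ?_
    rw [← Finset.sum_smul, hω n]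
    congr 1
    exact Finset.sum_congr rfl fun m _ => mul_comm _ _

end FiniteRank

/-! ### Moments of finite rank integrals -/

section FiniteRankMoments

variable {Ω K E : Type*} [MeasurableSpace Ω] {P : Measure Ω} [IsProbabilityMeasure P]
  [NormedAddCommGroup K] [InnerProductSpace ℝ K]
  [AddCommGroup E] [Module ℝ E] [MetricSpace E] [Norm E]
  [MeasurableSpace E] [BorelSpace E] [IsTopologicalAddGroup E] [ContinuousSMul ℝ E]
  [SecondCountableTopology E] {W : K → Lp ℝ 2 P}

theorem aemeasurable_finiteRankIntegral (W : K → Lp ℝ 2 P) {N : ℕ} (h : Fin N → K)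
    (x : Fin N → E) : AEMeasurable (finiteRankIntegral W h x) P := by
  have h1 : Measurable fun g : Fin N → ℝ => ∑ n, g n • x n :=
    (by fun_prop : Continuous fun g : Fin N → ℝ => ∑ n, g n • x n).measurable
  exact h1.comp_aemeasurable (IsIsonormal.aemeasurable_pi W h)

theorem IsIsonormal.lintegral_finiteRankIntegral (r : ℝ) [RNormedSpace r E] (hW : IsIsonormal W)
    (p : ℝ) {N : ℕ} {h : Fin N → K} (hh : Orthonormal ℝ h) (x : Fin N → E) :
    ∫⁻ ω, rnorm (finiteRankIntegral W h x ω) ^ p ∂P = gaussMoment p x := by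
  rw [gaussMoment, ← hW.map_orthonormal hh, lintegral_map'
    ((measurable_rnorm_gaussSum r x).pow_const p).aemeasurable (IsIsonormal.aemeasurable_pi W h)]
  rfl

/-- Rewritten over an orthonormal family `e`, the integral has the coefficients `finiteRankOp h x (e
m)`, so its moment is one of the terms in the supremum defining the `γ^p`-norm. -/
theorem IsIsonormal.lintegral_finiteRankIntegral_le (r : ℝ) [RNormedSpace r E]
    (hW : IsIsonormal W) {p : ℝ} (hp : 0 < p) {N : ℕ} (h : Fin N → K) (x : Fin N → E) :
    ∫⁻ ω, rnorm (finiteRankIntegral W h x ω) ^ p ∂P ≤ gammaNorm p (finiteRankOp h x) ^ p := by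
  obtain ⟨M, e, y, he, hop, hint⟩ := hW.exists_orthonormal h x
  calc ∫⁻ ω, rnorm (finiteRankIntegral W h x ω) ^ p ∂P
      = ∫⁻ ω, rnorm (finiteRankIntegral W e y ω) ^ p ∂P :=
        lintegral_congr_ae (by filter_upwards [hint] with ω hω; rw [hω])
    _ = gaussMoment p fun m => finiteRankOp h x (e m) := by
        rw [hW.lintegral_finiteRankIntegral r p he, ← hop]
        congr 1
        exact (funext fun m => finiteRankOp_apply_self he y m).symm
    _ ≤ _ := gaussMoment_le hp _ he

theorem IsIsonormal.lintegral_finiteRankIntegral_sub_le (r : ℝ) [RNormedSpace r E]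
    (hW : IsIsonormal W) {p : ℝ} (hp : 0 < p) {M N : ℕ} (h : Fin M → K) (x : Fin M → E)
    (h' : Fin N → K) (x' : Fin N → E) :
    ∫⁻ ω, rnorm (finiteRankIntegral W h x ω - finiteRankIntegral W h' x' ω) ^ p ∂P ≤
      gammaNorm p (finiteRankOp h x - finiteRankOp h' x') ^ p := by
  rw [← finiteRankOp_append_neg]
  simp_rw [← finiteRankIntegral_append_neg]
  exact hW.lintegral_finiteRankIntegral_le r hp _ _

end FiniteRankMoments

/-! ### Almost sure convergence at a geometric rate -/

section Convergence

variable {Ω E : Type*} [MeasurableSpace Ω] {P : Measure Ω}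

/-- Fatou's lemma, in the form that transfers moment bounds to almost sure limits. -/
theorem lintegral_le_of_tendsto_ae {f : ℕ → Ω → ℝ≥0∞} {g : Ω → ℝ≥0∞}
    (hf : ∀ k, AEMeasurable (f k) P) (hlim : ∀ᵐ ω ∂P, Tendsto (fun k => f k ω) atTop (𝓝 (g ω)))
    {B : ℝ≥0∞} (hB : ∀ᶠ k in atTop, ∫⁻ ω, f k ω ∂P ≤ B) : ∫⁻ ω, g ω ∂P ≤ B := by
  calc ∫⁻ ω, g ω ∂P = ∫⁻ ω, liminf (fun k => f k ω) atTop ∂P :=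
        lintegral_congr_ae (by filter_upwards [hlim] with ω hω using hω.liminf_eq.symm)
    _ ≤ liminf (fun k => ∫⁻ ω, f k ω ∂P) atTop := lintegral_liminf_le' hf
    _ ≤ B := liminf_le_of_frequently_le' hB.frequently

theorem tsum_const_mul_pow_ne_top {C c : ℝ≥0∞} (hC : C ≠ ∞) (hc : c < 1) :
    ∑' k : ℕ, C * c ^ k ≠ ∞ := by
  rw [ENNReal.tsum_mul_left, ENNReal.tsum_geometric]
  exact ENNReal.mul_ne_top hC (ENNReal.inv_ne_top.2 (tsub_pos_of_lt hc).ne')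

theorem ae_tsum_ne_top {f : ℕ → Ω → ℝ≥0∞} (hf : ∀ k, AEMeasurable (f k) P) {C c : ℝ≥0∞}
    (hC : C ≠ ∞) (hc : c < 1) (h : ∀ k, ∫⁻ ω, f k ω ∂P ≤ C * c ^ k) :
    ∀ᵐ ω ∂P, ∑' k, f k ω ≠ ∞ := by
  have h1 : ∫⁻ ω, ∑' k, f k ω ∂P ≠ ∞ := by
    rw [lintegral_tsum hf]
    exact ne_top_of_le_ne_top (tsum_const_mul_pow_ne_top hC hc) (ENNReal.tsum_le_tsum h)
  filter_upwards [ae_lt_top' (AEMeasurable.tsum hf) h1] with ω hω using hω.ne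

variable [AddCommGroup E] [Module ℝ E] [MetricSpace E] [Norm E]
  [MeasurableSpace E] [BorelSpace E] [IsTopologicalAddGroup E] [ContinuousSMul ℝ E]
  [SecondCountableTopology E]

theorem ae_tendsto_of_lintegral_rnorm_sub_le (r : ℝ) [RNormedSpace r E] {Z : ℕ → Ω → E}
    {X : Ω → E} (hZ : ∀ k, AEMeasurable (Z k) P) (hX : AEMeasurable X P) {C c : ℝ≥0∞}
    (hC : C ≠ ∞) (hc : c < 1) (h : ∀ k, ∫⁻ ω, rnorm (Z k ω - X ω) ^ (2 : ℝ) ∂P ≤ C * c ^ k) :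
    ∀ᵐ ω ∂P, Tendsto (fun k => Z k ω) atTop (𝓝 (X ω)) := by
  filter_upwards [ae_tsum_ne_top (fun k =>
    ((measurable_rnorm r).comp_aemeasurable ((hZ k).sub hX)).pow_const (2 : ℝ)) hC hc h] with ω hω
  rw [tendsto_iff_rnorm_sub r]
  have h1 := ENNReal.tendsto_atTop_zero_of_tsum_ne_top hω
  have h2 := (ENNReal.continuous_rpow_const (y := (2 : ℝ)⁻¹)).tendsto 0 |>.comp h1
  rw [ENNReal.zero_rpow_of_pos (by norm_num)] at h2
  refine h2.congr fun k => ?_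
  simp only [Function.comp_apply]
  rw [ENNReal.rpow_rpow_inv (by norm_num)]
  rfl

/-- A sequence that is geometrically Cauchy in `L²(Ω;E)` converges almost surely. -/
theorem exists_ae_tendsto_of_lintegral_rnorm_sub_le (r : ℝ) [RNormedSpace r E] [CompleteSpace E]
    {Z : ℕ → Ω → E} (hZ : ∀ k, AEMeasurable (Z k) P) {C : ℝ≥0∞} (hC : C ≠ ∞)
    (h : ∀ k, ∫⁻ ω, rnorm (Z (k + 1) ω - Z k ω) ^ (2 : ℝ) ∂P ≤ C * (1 / 4) ^ k) :
    ∃ X : Ω → E, Measurable X ∧ ∀ᵐ ω ∂P, Tendsto (fun k => Z k ω) atTop (𝓝 (X ω)) := by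
  have hr := RNormedSpace.r_pos (r := r) E
  have hhalf : (1 / 2 : ℝ≥0∞) < 1 := by
    rw [one_div]; exact ENNReal.inv_lt_one.2 (by norm_num)
  have h24 : (2 : ℝ≥0∞) * (1 / 4) = 1 / 2 := by
    rw [← ENNReal.toReal_eq_toReal_iff' (ENNReal.mul_ne_top (by norm_num) (by norm_num))
      (by norm_num)]
    norm_num
  have h22 : (2 : ℝ≥0∞) * (1 / 2) = 1 := by
    rw [one_div]; exact ENNReal.mul_inv_cancel (by norm_num) (by norm_num)
  have hm (k : ℕ) : AEMeasurable (fun ω => rnorm (Z (k + 1) ω - Z k ω) ^ (2 : ℝ)) P :=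
    ((measurable_rnorm r).comp_aemeasurable ((hZ (k + 1)).sub (hZ k))).pow_const (2 : ℝ)
  -- The weight `2^k` spends half of the rate `4^(-k)` on summability; the other half leaves the
  -- pathwise bound `S 2^(-k)` for the squared increments, and thus a geometric Cauchy sequence in
  -- the metric.
  have h1 := ae_tsum_ne_top (f := fun k ω => 2 ^ k * rnorm (Z (k + 1) ω - Z k ω) ^ (2 : ℝ))
    (fun k => (hm k).const_mul _) hC hhalf (fun k => by
      rw [lintegral_const_mul'' _ (hm k)]
      calc _ ≤ 2 ^ k * (C * (1 / 4) ^ k) := by gcongr; exact h k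
        _ = C * (1 / 2) ^ k := by rw [← h24, mul_pow]; ring)
  refine measurable_limit_of_tendsto_metrizable_ae hZ ?_
  filter_upwards [h1] with ω hω
  refine cauchySeq_tendsto_of_complete ?_
  set S := ∑' k, (2 : ℝ≥0∞) ^ k * rnorm (Z (k + 1) ω - Z k ω) ^ (2 : ℝ) with hS
  refine cauchySeq_of_edist_le_geometric ((1 / 2 : ℝ≥0∞) ^ (r / 2)) (S ^ (r / 2))
    (ENNReal.rpow_lt_one hhalf (by positivity))
    (ENNReal.rpow_ne_top_of_nonneg (by positivity) hω) fun k => ?_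
  rw [edist_comm, ← rnorm_rpow_eq_edist r]
  have h2 : rnorm (Z (k + 1) ω - Z k ω) ^ (2 : ℝ) ≤ S * (1 / 2) ^ k := by
    have h3 : 2 ^ k * rnorm (Z (k + 1) ω - Z k ω) ^ (2 : ℝ) ≤ S :=
      ENNReal.le_tsum (f := fun k => 2 ^ k * rnorm (Z (k + 1) ω - Z k ω) ^ (2 : ℝ)) k
    calc rnorm (Z (k + 1) ω - Z k ω) ^ (2 : ℝ)
        = (2 ^ k * rnorm (Z (k + 1) ω - Z k ω) ^ (2 : ℝ)) * (1 / 2) ^ k := by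
          rw [mul_right_comm, ← mul_pow, h22, one_pow, one_mul]
      _ ≤ _ := by gcongr
  calc rnorm (Z (k + 1) ω - Z k ω) ^ r = (rnorm (Z (k + 1) ω - Z k ω) ^ (2 : ℝ)) ^ (r / 2) := by
        rw [← ENNReal.rpow_mul]; congr 1; ring
    _ ≤ (S * (1 / 2) ^ k) ^ (r / 2) := ENNReal.rpow_le_rpow h2 (by positivity)
    _ = S ^ (r / 2) * ((1 / 2 : ℝ≥0∞) ^ (r / 2)) ^ k := by
        rw [ENNReal.mul_rpow_of_nonneg _ _ (by positivity)]
        congr 1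
        rw [← ENNReal.rpow_natCast, ← ENNReal.rpow_natCast, ← ENNReal.rpow_mul,
          ← ENNReal.rpow_mul, mul_comm]

end Convergence

/-! ### Stochastic integrals: boundedness, almost sure approximation, existence -/

section StochIntegral

variable {Ω K E : Type*} [MeasurableSpace Ω] {P : Measure Ω} [IsProbabilityMeasure P]
  [NormedAddCommGroup K] [InnerProductSpace ℝ K]
  [AddCommGroup E] [Module ℝ E] [MetricSpace E] [Norm E]
  [MeasurableSpace E] [BorelSpace E] [IsTopologicalAddGroup E] [ContinuousSMul ℝ E]
  [SecondCountableTopology E] {W : K → Lp ℝ 2 P}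

theorem aemeasurable_rnorm_rpow (r : ℝ) [RNormedSpace r E] (p : ℝ) {X : Ω → E}
    (hX : AEMeasurable X P) : AEMeasurable (fun ω => rnorm (X ω) ^ p) P :=
  ((measurable_rnorm r).comp_aemeasurable hX).pow_const p

theorem lintegral_rnorm_add_rpow_le (r : ℝ) [RNormedSpace r E] {p : ℝ} (hp : 0 < p) {X Y : Ω → E}
    (hX : AEMeasurable X P) : ∫⁻ ω, rnorm (X ω + Y ω) ^ p ∂P ≤
      quasiConst r p * (∫⁻ ω, rnorm (X ω) ^ p ∂P + ∫⁻ ω, rnorm (Y ω) ^ p ∂P) := by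
  rw [← lintegral_add_left' (aemeasurable_rnorm_rpow r p hX),
    ← lintegral_const_mul' _ _ (quasiConst_ne_top r p)]
  exact lintegral_mono fun ω => rnorm_add_rpow_le r hp _ _

/-- In the definition of the stochastic integral, the finite families need not be orthonormal. -/
theorem IsStochIntegral.of_families (hW : IsIsonormal W) {R : K →ₗ[ℝ] E} {X : Ω → E}
    (hX : AEMeasurable X P) {N : ℕ → ℕ} (h : ∀ k, Fin (N k) → K) (x : ∀ k, Fin (N k) → E)
    (hγ : Tendsto (fun k => gammaNorm 2 (R - finiteRankOp (h k) (x k)) ^ (2 : ℝ)) atTop (𝓝 0))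
    (hL : Tendsto (fun k => ∫⁻ ω, rnorm (X ω - finiteRankIntegral W (h k) (x k) ω) ^ (2 : ℝ) ∂P)
      atTop (𝓝 0)) : IsStochIntegral W R X := by
  choose M e y he hop hint using fun k => hW.exists_orthonormal (h k) (x k)
  refine ⟨hX, M, e, y, he, ?_, ?_⟩
  · simp_rw [hop]
    have h2 := (ENNReal.continuous_rpow_const (y := (2 : ℝ)⁻¹)).tendsto 0 |>.comp hγ
    rw [ENNReal.zero_rpow_of_pos (by norm_num)] at h2
    refine h2.congr fun k => ?_
    rw [Function.comp_apply, ENNReal.rpow_rpow_inv (by norm_num)]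
  · refine hL.congr fun k => lintegral_congr_ae ?_
    filter_upwards [hint k] with ω hω
    rw [← hω]
    rfl

theorem gammaNorm_zero (r : ℝ) [RNormedSpace r E] : gammaNorm 2 (0 : K →ₗ[ℝ] E) = 0 := by
  have h : gammaNorm 2 (0 : K →ₗ[ℝ] E) ^ (2 : ℝ) ≤ 0 := by
    refine gammaNorm_rpow_le two_pos fun N h _ => ?_
    simp [gaussMoment, rnorm_zero r]
  simpa using h

theorem isStochIntegral_finiteRankOp (r : ℝ) [RNormedSpace r E] (hW : IsIsonormal W) {N : ℕ}
    (h : Fin N → K) (x : Fin N → E) :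
    IsStochIntegral W (finiteRankOp h x) (finiteRankIntegral W h x) := by
  refine .of_families hW (aemeasurable_finiteRankIntegral W h x) (fun _ => h) (fun _ => x) ?_ ?_
  · simp [gammaNorm_zero r]
  · simp [rnorm_zero r]

theorem IsStochIntegral.exists_families {R : K →ₗ[ℝ] E} {X : Ω → E} (hX : IsStochIntegral W R X) :
    ∃ (N : ℕ → ℕ) (h : ∀ k, Fin (N k) → K) (x : ∀ k, Fin (N k) → E),
      Tendsto (fun k => gammaNorm 2 (R - finiteRankOp (h k) (x k)) ^ (2 : ℝ)) atTop (𝓝 0) ∧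
      Tendsto (fun k => ∫⁻ ω, rnorm (X ω - finiteRankIntegral W (h k) (x k) ω) ^ (2 : ℝ) ∂P)
        atTop (𝓝 0) := by
  obtain ⟨-, N, h, x, -, h1, h2⟩ := hX
  refine ⟨N, h, x, ?_, h2⟩
  have h3 := (ENNReal.continuous_rpow_const (y := (2 : ℝ))).tendsto 0 |>.comp h1
  rw [ENNReal.zero_rpow_of_pos (by norm_num)] at h3
  exact h3

theorem IsStochIntegral.sub (r : ℝ) [RNormedSpace r E] (hW : IsIsonormal W) {R R' : K →ₗ[ℝ] E}
    {X X' : Ω → E} (hX : IsStochIntegral W R X) (hX' : IsStochIntegral W R' X') :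
    IsStochIntegral W (R - R') (fun ω => X ω - X' ω) := by
  have hXm := hX.1
  have hXm' := hX'.1
  obtain ⟨N, h, x, h1, h2⟩ := hX.exists_families
  obtain ⟨N', h', x', h1', h2'⟩ := hX'.exists_families
  refine .of_families hW (hXm.sub hXm') (fun k => Fin.append (h k) (h' k))
    (fun k => Fin.append (x k) (-x' k)) ?_ ?_
  · have h3 := ENNReal.Tendsto.const_mul (h1.add h1') (Or.inr (quasiConst_ne_top r 2))
    rw [add_zero, mul_zero] at h3
    refine tendsto_of_tendsto_of_tendsto_of_le_of_le tendsto_const_nhds h3 (fun _ => zero_le)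
      fun k => ?_
    dsimp only
    rw [finiteRankOp_append_neg, sub_sub_sub_comm]
    exact gammaNorm_sub_rpow_le r two_pos _ _
  · have h3 := ENNReal.Tendsto.const_mul (h2.add h2') (Or.inr (quasiConst_ne_top r 2))
    rw [add_zero, mul_zero] at h3
    refine tendsto_of_tendsto_of_tendsto_of_le_of_le tendsto_const_nhds h3 (fun _ => zero_le)
      fun k => ?_
    dsimp only
    have h4 (ω : Ω) : X ω - X' ω - finiteRankIntegral W (Fin.append (h k) (h' k))
        (Fin.append (x k) (-x' k)) ω = (X ω - finiteRankIntegral W (h k) (x k) ω) +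
          -(X' ω - finiteRankIntegral W (h' k) (x' k) ω) := by
      rw [finiteRankIntegral_append_neg]; abel
    simp_rw [h4]
    refine (lintegral_rnorm_add_rpow_le r two_pos
      (hXm.sub (aemeasurable_finiteRankIntegral W (h k) (x k)))).trans ?_
    simp_rw [rnorm_neg r]
    rfl

/-- The stochastic integral is bounded from `γ(K,E)` to `L²(Ω;E)`. -/
theorem IsStochIntegral.lintegral_le (r : ℝ) [RNormedSpace r E] (hW : IsIsonormal W)
    {R : K →ₗ[ℝ] E} {X : Ω → E} (hX : IsStochIntegral W R X) :
    ∫⁻ ω, rnorm (X ω) ^ (2 : ℝ) ∂P ≤ quasiConst r 2 ^ 2 * gammaNorm 2 R ^ (2 : ℝ) := by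
  have hXm := hX.1
  obtain ⟨N, h, x, h1, h2⟩ := hX.exists_families
  set q := quasiConst r 2 with hq
  have hqt : q ≠ ∞ := quasiConst_ne_top r 2
  have hlim := ENNReal.Tendsto.const_mul (h2.add (ENNReal.Tendsto.const_mul
    ((tendsto_const_nhds (x := gammaNorm 2 R ^ (2 : ℝ))).add h1) (Or.inr hqt))) (Or.inr hqt)
  rw [zero_add, add_zero, ← mul_assoc, ← sq] at hlim
  refine ge_of_tendsto' hlim fun k => ?_
  have h3 := lintegral_rnorm_add_rpow_le r (p := 2) two_pos
    (Y := fun ω => finiteRankIntegral W (h k) (x k) ω)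
    (hXm.sub (aemeasurable_finiteRankIntegral W (h k) (x k)))
  simp only [Pi.sub_apply, sub_add_cancel] at h3
  refine h3.trans ?_
  gcongr _ * (_ + ?_)
  refine (hW.lintegral_finiteRankIntegral_le r two_pos (h k) (x k)).trans ?_
  have h4 := gammaNorm_sub_rpow_le r (p := 2) two_pos R (R - finiteRankOp (h k) (x k))
  rwa [sub_sub_cancel] at h4

/-- The families are arbitrary, not those witnessing that `X` is an integral: by linearity and
boundedness, `X` minus the `k`-th finite rank integral is controlled by the `k`-th operator error.
Two integrals of `R` are therefore almost surely equal once such families exist. -/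
theorem IsStochIntegral.ae_tendsto (r : ℝ) [RNormedSpace r E] (hW : IsIsonormal W)
    {R : K →ₗ[ℝ] E} {X : Ω → E} (hX : IsStochIntegral W R X) {N : ℕ → ℕ}
    {h : ∀ k, Fin (N k) → K} {x : ∀ k, Fin (N k) → E} {C : ℝ≥0∞} (hC : C ≠ ∞)
    (hγ : ∀ k, gammaNorm 2 (R - finiteRankOp (h k) (x k)) ^ (2 : ℝ) ≤ C * (1 / 4) ^ k) :
    ∀ᵐ ω ∂P, Tendsto (fun k => finiteRankIntegral W (h k) (x k) ω) atTop (𝓝 (X ω)) := by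
  refine ae_tendsto_of_lintegral_rnorm_sub_le r
    (fun k => aemeasurable_finiteRankIntegral W (h k) (x k)) hX.1
    (C := quasiConst r 2 ^ 2 * C) (c := 1 / 4)
    (ENNReal.mul_ne_top (ENNReal.pow_ne_top (quasiConst_ne_top r 2)) hC) ?_ fun k => ?_
  · rw [one_div]; exact ENNReal.inv_lt_one.2 (by norm_num)
  · have h1 := (hX.sub r hW (isStochIntegral_finiteRankOp r hW (h k) (x k))).lintegral_le r hW
    simp_rw [rnorm_sub_comm r (finiteRankIntegral W (h k) (x k) _)]
    refine h1.trans ?_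
    rw [mul_assoc]
    gcongr
    exact hγ k

/-- The finite rank integrals are geometrically Cauchy in second moment, hence converge almost
surely by completeness of `E`; Fatou applied to the differences upgrades this to convergence in
`L²(Ω;E)`. -/
theorem exists_isStochIntegral (r : ℝ) [RNormedSpace r E] [CompleteSpace E] (hW : IsIsonormal W)
    {R : K →ₗ[ℝ] E} {N : ℕ → ℕ} {h : ∀ k, Fin (N k) → K} {x : ∀ k, Fin (N k) → E} {C : ℝ≥0∞}
    (hC : C ≠ ∞)
    (hγ : ∀ k, gammaNorm 2 (R - finiteRankOp (h k) (x k)) ^ (2 : ℝ) ≤ C * (1 / 4) ^ k) :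
    ∃ X, IsStochIntegral W R X := by
  have h4 : (1 / 4 : ℝ≥0∞) < 1 := by rw [one_div]; exact ENNReal.inv_lt_one.2 (by norm_num)
  set C' := quasiConst r 2 * (C + C) with hC'
  have hC't : C' ≠ ∞ :=
    ENNReal.mul_ne_top (quasiConst_ne_top r 2) (ENNReal.add_ne_top.2 ⟨hC, hC⟩)
  have hJ (k l : ℕ) (hkl : k ≤ l) : ∫⁻ ω, rnorm (finiteRankIntegral W (h l) (x l) ω -
      finiteRankIntegral W (h k) (x k) ω) ^ (2 : ℝ) ∂P ≤ C' * (1 / 4) ^ k := by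
    refine (hW.lintegral_finiteRankIntegral_sub_le r two_pos (h l) (x l) (h k) (x k)).trans ?_
    have h1 := gammaNorm_sub_rpow_le r (p := 2) two_pos (R - finiteRankOp (h k) (x k))
      (R - finiteRankOp (h l) (x l))
    rw [sub_sub_sub_cancel_left] at h1
    refine h1.trans ?_
    rw [hC', mul_assoc, add_mul]
    gcongr _ * (?_ + ?_)
    · exact hγ k
    · exact (hγ l).trans (mul_le_mul_right (pow_le_pow_right_of_le_one' h4.le hkl) _)
  obtain ⟨X, hXm, hX⟩ := exists_ae_tendsto_of_lintegral_rnorm_sub_le r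
    (fun k => aemeasurable_finiteRankIntegral W (h k) (x k)) hC't
    (fun k => hJ k (k + 1) k.le_succ)
  have hgeo (B : ℝ≥0∞) (hB : B ≠ ∞) : Tendsto (fun k : ℕ => B * (1 / 4) ^ k) atTop (𝓝 0) := by
    have := ENNReal.Tendsto.const_mul (ENNReal.tendsto_pow_atTop_nhds_zero_of_lt_one h4)
      (Or.inr hB)
    rwa [mul_zero] at this
  refine ⟨X, .of_families hW hXm.aemeasurable h x ?_ ?_⟩
  · exact tendsto_of_tendsto_of_tendsto_of_le_of_le tendsto_const_nhds (hgeo C hC)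
      (fun _ => zero_le) hγ
  · refine tendsto_of_tendsto_of_tendsto_of_le_of_le tendsto_const_nhds (hgeo C' hC't)
      (fun _ => zero_le) fun k => ?_
    refine lintegral_le_of_tendsto_ae (f := fun l ω => rnorm (finiteRankIntegral W (h l) (x l) ω -
      finiteRankIntegral W (h k) (x k) ω) ^ (2 : ℝ)) (fun l => ?_) ?_
      (eventually_atTop.2 ⟨k, fun l hl => hJ k l hl⟩)
    · exact ((measurable_rnorm r).comp_aemeasurable
        ((aemeasurable_finiteRankIntegral W (h l) (x l)).sub
          (aemeasurable_finiteRankIntegral W (h k) (x k)))).pow_const (2 : ℝ)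
    · filter_upwards [hX] with ω hω
      exact (ENNReal.continuous_rpow_const.comp (continuous_rnorm r)).tendsto _ |>.comp
        (hω.sub_const _)

/-- An operator in `γ(K,E)` is the limit of its compositions with finite rank projections. -/
theorem IsGammaRadonifying.exists_approx (r : ℝ) [RNormedSpace r E] {R : K →ₗ[ℝ] E}
    (hR : IsGammaRadonifying R) :
    ∃ (C : ℝ≥0∞) (N : ℕ → ℕ) (h : ∀ k, Fin (N k) → K), C ≠ ∞ ∧ (∀ k, Orthonormal ℝ (h k)) ∧
      ∀ k, gammaNorm 2 (R - finiteRankOp (h k) (fun n => R (h k n))) ^ (2 : ℝ) ≤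
        C * (1 / 4) ^ k := by
  choose N h x hh hx using fun k : ℕ => hR.2 ((1 / 2) ^ k)
    (ENNReal.pow_pos (by rw [one_div]; exact ENNReal.inv_pos.2 (by norm_num)) k)
  set q := quasiConst r 2 with hq
  have hqt : q ≠ ∞ := quasiConst_ne_top r 2
  refine ⟨q * (1 + q * 2), N, h, ?_, hh, fun k => ?_⟩
  · exact ENNReal.mul_ne_top hqt (ENNReal.add_ne_top.2
      ⟨ENNReal.one_ne_top, ENNReal.mul_ne_top hqt (by norm_num)⟩)
  set S := R - finiteRankOp (h k) (x k) with hS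
  -- If `F` is the given approximant and `P` the projection onto the span of its family, then `F P =
  -- F`, so `R - R P = S - S P` with `S = R - F`. Replacing the coefficients by `R (h k n)` costs
  -- only a constant.
  have h1 : R - finiteRankOp (h k) (fun n => R (h k n)) = S - S ∘ₗ finiteRankOp (h k) (h k) := by
    rw [hS, LinearMap.sub_comp, comp_finiteRankOp, finiteRankOp_comp_projection (hh k)]
    abel
  have h2 : gammaNorm 2 S ^ (2 : ℝ) ≤ (1 / 4) ^ k := by
    calc gammaNorm 2 S ^ (2 : ℝ) ≤ ((1 / 2) ^ k) ^ (2 : ℝ) :=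
          ENNReal.rpow_le_rpow (hx k).le (by norm_num)
      _ = (1 / 4) ^ k := by
          rw [ENNReal.rpow_ofNat, ← pow_mul, mul_comm, pow_mul]
          congr 1
          rw [← ENNReal.toReal_eq_toReal_iff' (by norm_num) (by norm_num)]
          norm_num
  rw [h1]
  calc gammaNorm 2 (S - S ∘ₗ finiteRankOp (h k) (h k)) ^ (2 : ℝ)
      ≤ q * (gammaNorm 2 S ^ (2 : ℝ) + q * 2 * gammaNorm 2 S ^ (2 : ℝ)) := by
        refine (gammaNorm_sub_rpow_le r two_pos _ _).trans ?_
        gcongr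
        exact gammaNorm_comp_projection_le r two_pos S (isSymmetricProjection_finiteRankOp (hh k))
    _ = q * (1 + q * 2) * gammaNorm 2 S ^ (2 : ℝ) := by ring
    _ ≤ _ := by gcongr

end StochIntegral

/-- An increasing family of symmetric projections. -/
structure IsResolution {K ι : Type*} [NormedAddCommGroup K] [InnerProductSpace ℝ K] [LinearOrder ι]
    (A : ι → K →ₗ[ℝ] K) : Prop where
  isSymmetric : ∀ t, (A t).IsSymmetric
  comp : ∀ s t f, A s (A t f) = A (min s t) f

theorem IsResolution.isSymmetricProjection {K ι : Type*} [NormedAddCommGroup K]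
    [InnerProductSpace ℝ K] [LinearOrder ι] {A : ι → K →ₗ[ℝ] K} (hA : IsResolution A) (t : ι) :
    (A t).IsSymmetricProjection where
  isIdempotentElem := by ext f; rw [Module.End.mul_apply, hA.comp, min_self]
  isSymmetric := hA.isSymmetric t

/-! ### Lévy's maximal inequality for finite rank integrals -/

section Maximal

variable {Ω K E : Type*} [MeasurableSpace Ω] {P : Measure Ω} [IsProbabilityMeasure P]
  [NormedAddCommGroup K] [InnerProductSpace ℝ K]
  [AddCommGroup E] [Module ℝ E] [MetricSpace E] [Norm E]
  [MeasurableSpace E] [BorelSpace E] [IsTopologicalAddGroup E] [ContinuousSMul ℝ E]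
  [SecondCountableTopology E] {W : K → Lp ℝ 2 P}
  {ι : Type*} [LinearOrder ι] {A : ι → K →ₗ[ℝ] K}

theorem IsIsonormal.ae_reflectionOf (hW : IsIsonormal W) (A : K →ₗ[ℝ] K) {N : ℕ} (h : Fin N → K)
    (x : Fin N → E) : ∀ᵐ ω ∂P, (2 : ℝ) • finiteRankIntegral W (fun n => A (h n)) x ω =
      finiteRankIntegral W h x ω + finiteRankIntegral W (fun n => reflectionOf A (h n)) x ω := by
  have h1 : ∀ᵐ ω ∂P, ∀ n, 2 * W (A (h n)) ω = W (h n) ω + W (reflectionOf A (h n)) ω := by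
    rw [ae_all_iff]
    intro n
    have h2 : W (reflectionOf A (h n)) = (2 : ℝ) • W (A (h n)) - W (h n) := by
      change hW.toLinearMap _ = (2 : ℝ) • hW.toLinearMap _ - hW.toLinearMap _
      rw [reflectionOf_apply, map_sub, map_smul]
    filter_upwards [Lp.coeFn_sub ((2 : ℝ) • W (A (h n))) (W (h n)),
      Lp.coeFn_smul (2 : ℝ) (W (A (h n)))] with ω hω hω'
    rw [h2, hω, Pi.sub_apply, hω']
    simp
  filter_upwards [h1] with ω hω
  simp only [finiteRankIntegral, Finset.smul_sum, smul_smul, hω, add_smul, Finset.sum_add_distrib]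

/-- Lévy's maximal inequality for tails. -/
theorem IsIsonormal.measure_exists_lt_le (r : ℝ) [RNormedSpace r E] (hW : IsIsonormal W)
    (hA : IsResolution A) {N : ℕ} (h : Fin N → K) (x : Fin N → E) (D : Finset ι) (u : ℝ≥0∞) :
    P {ω | ∃ t ∈ D, u < rnorm (finiteRankIntegral W (fun n => A t (h n)) x ω)} ≤
      2 * P {ω | u < 2 ^ (1 / r - 1) * rnorm (finiteRankIntegral W h x ω)} := by
  classical
  set c : ℝ≥0∞ := 2 ^ (1 / r - 1) with hc
  set Y : ι → Ω → E := fun t => finiteRankIntegral W (fun n => A t (h n)) x with hY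
  set Z : Ω → E := finiteRankIntegral W h x with hZ
  set F : Set Ω := {ω | u < c * rnorm (Z ω)} with hF
  -- The event that `t` is the first time in `D` at which the level `u` is exceeded.
  let G : ι → Set Ω := fun t => {ω | u < rnorm (Y t ω) ∧ ∀ s ∈ D, s < t → rnorm (Y s ω) ≤ u}
  have hrm (V : Ω → E) (hV : AEMeasurable V P) : AEMeasurable (fun ω => rnorm (V ω)) P :=
    (measurable_rnorm r).comp_aemeasurable hV
  have hGm (t : ι) : NullMeasurableSet (G t) P := by
    refine (nullMeasurableSet_lt aemeasurable_const
      (hrm _ (aemeasurable_finiteRankIntegral W _ x))).inter ?_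
    have : {ω | ∀ s ∈ D, s < t → rnorm (Y s ω) ≤ u} =
        ⋂ s ∈ D.filter (· < t), {ω | rnorm (Y s ω) ≤ u} := by ext; simp
    change NullMeasurableSet {ω | ∀ s ∈ D, s < t → rnorm (Y s ω) ≤ u} P
    rw [this]
    exact NullMeasurableSet.biInter (Finset.countable_toSet _) fun s _ =>
      nullMeasurableSet_le (hrm _ (aemeasurable_finiteRankIntegral W _ x)) aemeasurable_const
  have hFm : NullMeasurableSet F P := nullMeasurableSet_lt aemeasurable_const
    ((hrm _ (aemeasurable_finiteRankIntegral W h x)).const_mul c)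
  have hstep (t : ι) (ht : t ∈ D) : P (G t) ≤ 2 * P (G t ∩ F) := by
    set Z' : Ω → E := finiteRankIntegral W (fun n => reflectionOf (A t) (h n)) x with hZ'
    -- The index `none` carries the terminal value `Z` and `some s` the value at time `s`, so that
    -- `B` describes `G t ∩ F` through one finite Gaussian vector.
    let a : Option D × Fin N → K := fun i => i.1.elim (h i.2) fun s => A s (h i.2)
    let B : Set (Option D × Fin N → ℝ) :=
      {g | (u < rnorm (∑ n, g (some ⟨t, ht⟩, n) • x n) ∧
        ∀ s : D, (s : ι) < t → rnorm (∑ n, g (some s, n) • x n) ≤ u) ∧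
        u < c * rnorm (∑ n, g (none, n) • x n)}
    have hBm : MeasurableSet B := by
      have hm (i : Option D) :
          Measurable fun g : Option D × Fin N → ℝ => rnorm (∑ n, g (i, n) • x n) :=
        ((continuous_rnorm r).comp (by fun_prop)).measurable
      refine MeasurableSet.inter (MeasurableSet.inter (measurableSet_lt measurable_const (hm _)) ?_)
        (measurableSet_lt measurable_const ((hm _).const_mul c))
      have : {g : Option D × Fin N → ℝ | ∀ s : D, (s : ι) < t →
          rnorm (∑ n, g (some s, n) • x n) ≤ u} =
          ⋂ (s : D) (_ : (s : ι) < t), {g | rnorm (∑ n, g (some s, n) • x n) ≤ u} := by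
        ext; simp
      change MeasurableSet {g : Option D × Fin N → ℝ | ∀ s : D, (s : ι) < t →
          rnorm (∑ n, g (some s, n) • x n) ≤ u}
      rw [this]
      exact MeasurableSet.iInter fun s => MeasurableSet.iInter fun _ =>
        measurableSet_le (hm _) measurable_const
    have hlaw : P (G t ∩ F) = P (G t ∩ {ω | u < c * rnorm (Z' ω)}) := by
      -- Reflecting preserves the Gram matrix, hence the joint law. It fixes the values at times `s
      -- ≤ t`, so `G t` is unchanged while `Z` becomes `Z'`.
      have h1 := hW.map_pi_eq (a := fun i => reflectionOf (A t) (a i)) (b := a)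
        fun i j => inner_reflectionOf (hA.isSymmetricProjection t) _ _
      have h2 := congrArg (fun μ : Measure (Option D × Fin N → ℝ) => μ B) h1
      rw [Measure.map_apply_of_aemeasurable (IsIsonormal.aemeasurable_pi W _) hBm,
        Measure.map_apply_of_aemeasurable (IsIsonormal.aemeasurable_pi W _) hBm] at h2
      have hfix (s : D) (hs : (s : ι) ≤ t) (n : Fin N) :
          reflectionOf (A t) (a (some s, n)) = A s (h n) := by
        change reflectionOf (A t) (A s (h n)) = _
        rw [reflectionOf_apply, hA.comp, min_eq_right hs, two_smul, add_sub_cancel_right]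
      have e1 : (fun ω i => W (a i) ω) ⁻¹' B = G t ∩ F := by
        ext ω
        simp [B, a, G, hF, hY, hZ, finiteRankIntegral]
      have e2 : (fun ω i => W (reflectionOf (A t) (a i)) ω) ⁻¹' B =
          G t ∩ {ω | u < c * rnorm (Z' ω)} := by
        ext ω
        simp only [B, G, hY, hZ', finiteRankIntegral, Set.mem_preimage, Set.mem_inter_iff,
          Set.mem_ofPred_eq]
        rw [show (∑ n, W (reflectionOf (A t) (a (some ⟨t, ht⟩, n))) ω • x n) =
          ∑ n, W (A t (h n)) ω • x n from
            Finset.sum_congr rfl fun n _ => by rw [hfix ⟨t, ht⟩ le_rfl]]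
        refine and_congr (and_congr Iff.rfl ?_) Iff.rfl
        constructor
        · intro H s hs hst
          have := H ⟨s, hs⟩ hst
          rwa [show (∑ n, W (reflectionOf (A t) (a (some ⟨s, hs⟩, n))) ω • x n) =
            ∑ n, W (A s (h n)) ω • x n from
              Finset.sum_congr rfl fun n _ => by rw [hfix ⟨s, hs⟩ hst.le]] at this
        · intro H s hst
          have := H s s.2 hst
          rwa [show (∑ n, W (reflectionOf (A t) (a (some s, n))) ω • x n) =
            ∑ n, W (A s (h n)) ω • x n from
              Finset.sum_congr rfl fun n _ => by rw [hfix s hst.le]]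
      rw [← e1, ← e2, h2]
    have hsub : G t ≤ᵐ[P] ((G t ∩ F) ∪ (G t ∩ {ω | u < c * rnorm (Z' ω)}) : Set Ω) := by
      filter_upwards [hW.ae_reflectionOf (A t) h x] with ω hω hGω
      -- Since `2 Y_t = Z + Z'`, on `G t` at least one of `Z`, `Z'` is large, and the two
      -- alternatives are equally likely.
      have h1 := rnorm_le_max_of_two_smul r hω
      have h2 : u < c * max (rnorm (Z ω)) (rnorm (Z' ω)) := lt_of_lt_of_le hGω.1 h1
      rcases max_choice (rnorm (Z ω)) (rnorm (Z' ω)) with h3 | h3 <;> rw [h3] at h2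
      · exact Or.inl ⟨hGω, h2⟩
      · exact Or.inr ⟨hGω, h2⟩
    calc P (G t) ≤ P ((G t ∩ F) ∪ (G t ∩ {ω | u < c * rnorm (Z' ω)})) := measure_mono_ae hsub
      _ ≤ P (G t ∩ F) + P (G t ∩ {ω | u < c * rnorm (Z' ω)}) := measure_union_le _ _
      _ = 2 * P (G t ∩ F) := by rw [← hlaw, two_mul]
  have hcover : {ω | ∃ t ∈ D, u < rnorm (Y t ω)} ⊆ ⋃ t ∈ D, G t := by
    intro ω hω
    have hne : (D.filter fun t => u < rnorm (Y t ω)).Nonempty := by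
      obtain ⟨t, ht, htu⟩ := hω
      exact ⟨t, Finset.mem_filter.2 ⟨ht, htu⟩⟩
    have hmem := Finset.mem_filter.1 (Finset.min'_mem _ hne)
    refine Set.mem_iUnion₂.2 ⟨_, hmem.1, hmem.2, fun s hs hst => ?_⟩
    by_contra! hlt
    exact absurd (Finset.min'_le _ s (Finset.mem_filter.2 ⟨hs, hlt⟩)) (not_le.2 hst)
  have hdisj : (D : Set ι).Pairwise (Function.onFun (AEDisjoint P) fun t => G t ∩ F) := by
    intro s hs t ht hst
    refine Disjoint.aedisjoint (Set.disjoint_left.2 ?_)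
    rintro ω ⟨h1, -⟩ ⟨h2, -⟩
    rcases lt_or_gt_of_ne hst with hlt | hlt
    · exact absurd (h2.2 s hs hlt) (not_le.2 h1.1)
    · exact absurd (h1.2 t ht hlt) (not_le.2 h2.1)
  calc P {ω | ∃ t ∈ D, u < rnorm (Y t ω)} ≤ ∑ t ∈ D, P (G t) :=
        (measure_mono hcover).trans (measure_biUnion_finset_le _ _)
    _ ≤ ∑ t ∈ D, 2 * P (G t ∩ F) := Finset.sum_le_sum hstep
    _ = 2 * P (⋃ t ∈ D, G t ∩ F) := by
        rw [← Finset.mul_sum, measure_biUnion_finset₀ hdisj fun t _ => (hGm t).inter hFm]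
    _ ≤ 2 * P F := by
        gcongr
        exact Set.iUnion₂_subset fun t _ => Set.inter_subset_right

/-- Layer-cake formula on both sides; finite values are assumed so that its real-valued form
applies. -/
theorem lintegral_le_of_measure_lt_le {f g : Ω → ℝ≥0∞} (hf : AEMeasurable f P)
    (hg : AEMeasurable g P) (hf' : ∀ ω, f ω ≠ ∞) (hg' : ∀ ω, g ω ≠ ∞) {C : ℝ≥0∞} (hC : C ≠ ∞)
    (h : ∀ u : ℝ≥0∞, P {ω | u < f ω} ≤ C * P {ω | u < g ω}) :
    ∫⁻ ω, f ω ∂P ≤ C * ∫⁻ ω, g ω ∂P := by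
  have key (f : Ω → ℝ≥0∞) (hf : AEMeasurable f P) (hf' : ∀ ω, f ω ≠ ∞) :
      ∫⁻ ω, f ω ∂P = ∫⁻ t in Set.Ioi (0 : ℝ), P {ω | ENNReal.ofReal t < f ω} := by
    have h1 := lintegral_eq_lintegral_meas_lt P (f := fun ω => (f ω).toReal)
      (Eventually.of_forall fun ω => ENNReal.toReal_nonneg) hf.ennreal_toReal
    simp only [ENNReal.ofReal_toReal (hf' _)] at h1
    rw [h1]
    refine setLIntegral_congr_fun measurableSet_Ioi fun t ht => ?_
    congr 1
    ext ω
    exact (ENNReal.ofReal_lt_iff_lt_toReal (le_of_lt ht) (hf' ω)).symm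
  rw [key f hf hf', key g hg hg', ← lintegral_const_mul' _ _ hC]
  exact lintegral_mono fun t => h _

/-- The constant in Lévy's maximal inequality for `p`-th moments. -/
noncomputable def levyConst (r p : ℝ) : ℝ≥0∞ := 2 * (2 ^ (1 / r - 1)) ^ p

theorem levyConst_ne_top {r p : ℝ} (hp : 0 < p) : levyConst r p ≠ ∞ :=
  ENNReal.mul_ne_top (by norm_num) (ENNReal.rpow_ne_top_of_nonneg hp.le
    (ENNReal.rpow_ne_top_of_ne_zero (by norm_num) (by norm_num)))

theorem IsIsonormal.lintegral_sup_le (r : ℝ) [RNormedSpace r E] (hW : IsIsonormal W)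
    (hA : IsResolution A) {p : ℝ} (hp : 0 < p) {N : ℕ} (h : Fin N → K) (x : Fin N → E)
    (D : Finset ι) :
    ∫⁻ ω, D.sup (fun t => rnorm (finiteRankIntegral W (fun n => A t (h n)) x ω) ^ p) ∂P ≤
      levyConst r p * ∫⁻ ω, rnorm (finiteRankIntegral W h x ω) ^ p ∂P := by
  have hct : (2 : ℝ≥0∞) ^ (1 / r - 1) ≠ ∞ :=
    ENNReal.rpow_ne_top_of_ne_zero (by norm_num) (by norm_num)
  rw [levyConst, mul_assoc, ← lintegral_const_mul' _ _ (ENNReal.rpow_ne_top_of_nonneg hp.le hct)]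
  simp_rw [← ENNReal.mul_rpow_of_nonneg _ _ hp.le]
  refine lintegral_le_of_measure_lt_le ?_ ?_ ?_ ?_ (by norm_num) fun u => ?_
  · have : (fun ω => D.sup fun t => rnorm (finiteRankIntegral W (fun n => A t (h n)) x ω) ^ p) =
        fun ω => ⨆ t ∈ D, rnorm (finiteRankIntegral W (fun n => A t (h n)) x ω) ^ p :=
      funext fun ω => Finset.sup_eq_iSup _ _
    rw [this]
    exact AEMeasurable.biSup _ D.countable_toSet fun t _ =>
      aemeasurable_rnorm_rpow r p (aemeasurable_finiteRankIntegral W _ x)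
  · exact ((measurable_rnorm r).comp_aemeasurable
      (aemeasurable_finiteRankIntegral W h x)).const_mul _ |>.pow_const p
  · intro ω
    refine ((Finset.sup_lt_iff ENNReal.zero_lt_top).2 fun t _ => ?_).ne
    exact ENNReal.rpow_lt_top_of_nonneg hp.le (rnorm_ne_top _)
  · exact fun ω => ENNReal.rpow_ne_top_of_nonneg hp.le (ENNReal.mul_ne_top hct (rnorm_ne_top _))
  · have hiff (y : ℝ≥0∞) : u < y ^ p ↔ u ^ (1 / p) < y := by
      rw [one_div]
      exact (ENNReal.rpow_inv_lt_iff hp).symm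
    simp only [Finset.lt_sup_iff, hiff]
    exact hW.measure_exists_lt_le r hA h x D _

end Maximal

/-! ### Uniform continuity in probability and continuous versions -/

section ContinuousModification

variable {Ω ι X : Type*} [MeasurableSpace Ω] {P : Measure Ω} [PseudoMetricSpace ι]
  [PseudoEMetricSpace X]

/-- The event that `Z` oscillates by more than `ε` at distance `δ` along the set `D`. -/
def oscillationSet (Z : ι → Ω → X) (D : Set ι) (δ : ℝ) (ε : ℝ≥0∞) : Set Ω :=
  {ω | ∃ s ∈ D, ∃ t ∈ D, dist s t < δ ∧ ε < edist (Z s ω) (Z t ω)}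

/-- Uniform continuity in probability along finite sets. -/
def UniformContinuousInProbability (P : Measure Ω) (Z : ι → Ω → X) : Prop :=
  ∀ ε : ℝ≥0∞, 0 < ε → ∀ η : ℝ≥0∞, 0 < η → ∃ δ : ℝ, 0 < δ ∧
    ∀ D : Finset ι, P (oscillationSet Z D δ ε) ≤ η

theorem UniformContinuousInProbability.congr {Z Z' : ι → Ω → X}
    (hZ : UniformContinuousInProbability P Z) (h : ∀ t, Z t =ᵐ[P] Z' t) :
    UniformContinuousInProbability P Z' := by
  intro ε hε η hη
  obtain ⟨δ, hδ, H⟩ := hZ ε hε η hη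
  refine ⟨δ, hδ, fun D => le_trans (measure_mono_ae ?_) (H D)⟩
  have h1 : ∀ᵐ ω ∂P, ∀ t ∈ D, Z t ω = Z' t ω := (ae_ball_iff D.countable_toSet).2 fun t _ => h t
  filter_upwards [h1] with ω hω
  rintro ⟨s, hs, t, ht, hst, h2⟩
  exact ⟨s, hs, t, ht, hst, by rwa [hω s hs, hω t ht]⟩

theorem UniformContinuousInProbability.comp {X' : Type*} [PseudoEMetricSpace X'] {Z : ι → Ω → X}
    (hZ : UniformContinuousInProbability P Z) {φ : X → X'} (hφ : UniformContinuous φ) :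
    UniformContinuousInProbability P fun t ω => φ (Z t ω) := by
  intro ε hε η hη
  obtain ⟨ε', hε', H'⟩ := EMetric.uniformContinuous_iff.1 hφ ε hε
  obtain ⟨ε'', hε'', hlt⟩ := exists_between hε'
  obtain ⟨δ, hδ, H⟩ := hZ ε'' hε'' η hη
  refine ⟨δ, hδ, fun D => (measure_mono ?_).trans (H D)⟩
  rintro ω ⟨s, hs, t, ht, hst, h2⟩
  refine ⟨s, hs, t, ht, hst, ?_⟩
  by_contra! hle
  exact absurd (H' (hle.trans_lt hlt)) (not_lt.2 h2.le)

/-- A three-epsilon argument. The approximation must be simultaneous over all times of a finite set,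
with a bound independent of that set; maximal inequalities supply exactly this. -/
theorem uniformContinuousInProbability_of_approx {Z : ι → Ω → X}
    (h : ∀ ε : ℝ≥0∞, 0 < ε → ∀ η : ℝ≥0∞, 0 < η → ∃ Z' : ι → Ω → X,
      UniformContinuousInProbability P Z' ∧
      ∀ D : Finset ι, P {ω | ∃ t ∈ D, ε < edist (Z t ω) (Z' t ω)} ≤ η) :
    UniformContinuousInProbability P Z := by
  intro ε hε η hη
  have hε3 : 0 < ε / 3 := ENNReal.div_pos hε.ne' (by norm_num)
  have hη2 : 0 < η / 2 := ENNReal.div_pos hη.ne' (by norm_num)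
  obtain ⟨Z', hZ', H'⟩ := h (ε / 3) hε3 (η / 2) hη2
  obtain ⟨δ, hδ, H⟩ := hZ' (ε / 3) hε3 (η / 2) hη2
  refine ⟨δ, hδ, fun D => ?_⟩
  calc P (oscillationSet Z D δ ε)
      ≤ P ({ω | ∃ t ∈ D, ε / 3 < edist (Z t ω) (Z' t ω)} ∪ oscillationSet Z' D δ (ε / 3)) := by
        refine measure_mono ?_
        rintro ω ⟨s, hs, t, ht, hst, h2⟩
        by_contra hcon
        rw [Set.mem_union, not_or] at hcon
        obtain ⟨h3, h4⟩ := hcon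
        have h5 (t) (ht : t ∈ D) : edist (Z t ω) (Z' t ω) ≤ ε / 3 := by
          by_contra! hlt
          exact h3 ⟨t, ht, hlt⟩
        have h6 : edist (Z' s ω) (Z' t ω) ≤ ε / 3 := by
          by_contra! hlt
          exact h4 ⟨s, hs, t, ht, hst, hlt⟩
        refine absurd h2 (not_lt.2 ?_)
        calc edist (Z s ω) (Z t ω)
            ≤ edist (Z s ω) (Z' s ω) + edist (Z' s ω) (Z' t ω) + edist (Z' t ω) (Z t ω) :=
              edist_triangle4 _ _ _ _
          _ ≤ ε / 3 + ε / 3 + ε / 3 := by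
              gcongr
              · exact h5 s hs
              · rw [edist_comm]; exact h5 t ht
          _ = ε := ENNReal.add_thirds ε
    _ ≤ η / 2 + η / 2 := (measure_union_le _ _).trans (add_le_add (H' D) (H D))
    _ = η := ENNReal.add_halves η

/-- Almost every path of a process that is uniformly continuous in probability is uniformly
continuous along a given countable set. -/
theorem UniformContinuousInProbability.ae_uniformContinuous {Z : ι → Ω → X}
    (hZ : UniformContinuousInProbability P Z) {S : Set ι} (hS : S.Countable) :
    ∀ᵐ ω ∂P, UniformContinuous fun d : S => Z d ω := by
  have : Countable S := hS
  have key (ε : ℝ≥0∞) (hε : 0 < ε) :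
      ∀ᵐ ω ∂P, ∃ δ : ℝ, 0 < δ ∧ ω ∉ oscillationSet Z S δ ε := by
    rw [ae_iff]
    refine le_antisymm (le_of_forall_gt_imp_ge_of_dense fun η hη => ?_) zero_le
    obtain ⟨δ, hδ, H⟩ := hZ ε hε η hη
    have hunion : oscillationSet Z S δ ε ⊆
        ⋃ D : Finset S, oscillationSet Z (D.map (Function.Embedding.subtype _) : Finset ι) δ ε := by
      classical
      rintro ω ⟨s, hs, t, ht, hst, h2⟩
      refine Set.mem_iUnion.2 ⟨{⟨s, hs⟩, ⟨t, ht⟩}, s, ?_, t, ?_, hst, h2⟩ <;> simp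
    have hdir : Directed (· ⊆ ·) fun D : Finset S =>
        oscillationSet Z (D.map (Function.Embedding.subtype _) : Finset ι) δ ε := by
      refine Monotone.directed_le (f := fun D : Finset S =>
        oscillationSet Z (D.map (Function.Embedding.subtype _) : Finset ι) δ ε) ?_
      rintro D D' hDD' ω ⟨s, hs, t, ht, hst, h2⟩
      have hsub := Finset.coe_subset.2 (Finset.map_subset_map
        (f := Function.Embedding.subtype (· ∈ S)).2 hDD')
      exact ⟨s, hsub hs, t, hsub ht, hst, h2⟩
    calc P {ω | ¬ ∃ δ : ℝ, 0 < δ ∧ ω ∉ oscillationSet Z S δ ε}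
        ≤ P (oscillationSet Z S δ ε) := by
          refine measure_mono fun ω hω => ?_
          by_contra h
          exact hω ⟨δ, hδ, h⟩
      _ ≤ η := by
          -- A violation on `S` involves just two times, and the events increase with the finite
          -- set; continuity of the measure along a directed union keeps the uniform bound.
          refine (measure_mono hunion).trans ?_
          rw [hdir.measure_iUnion]
          exact iSup_le fun D => H _
  have h1 : ∀ᵐ ω ∂P, ∀ m : ℕ, ∃ δ : ℝ, 0 < δ ∧ ω ∉ oscillationSet Z S δ ((m : ℝ≥0∞)⁻¹) :=
    ae_all_iff.2 fun m => key _ (ENNReal.inv_pos.2 (ENNReal.natCast_ne_top m))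
  filter_upwards [h1] with ω hω
  rw [EMetric.uniformContinuous_iff]
  intro ε hε
  obtain ⟨m, hm⟩ := ENNReal.exists_inv_nat_lt hε.ne'
  obtain ⟨δ, hδ, H⟩ := hω m
  refine ⟨ENNReal.ofReal δ, ENNReal.ofReal_pos.2 hδ, fun {a b} hab => ?_⟩
  refine lt_of_le_of_lt ?_ hm
  by_contra! hlt
  refine H ⟨a, a.2, b, b.2, ?_, hlt⟩
  rwa [edist_dist, ENNReal.ofReal_lt_ofReal_iff hδ] at hab

end ContinuousModification

/-- A process that is uniformly continuous in probability has a version with continuous paths. -/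
theorem UniformContinuousInProbability.exists_continuous_modification {Ω ι X : Type*}
    [MeasurableSpace Ω] {P : Measure Ω} [IsFiniteMeasure P] [PseudoMetricSpace ι]
    [TopologicalSpace.SeparableSpace ι] [MetricSpace X] [CompleteSpace X] [MeasurableSpace X]
    [BorelSpace X] [Nonempty X] {Z : ι → Ω → X} (hZ : UniformContinuousInProbability P Z)
    (hm : ∀ t, AEMeasurable (Z t) P) :
    ∃ Y : ι → Ω → X, (∀ t, Measurable (Y t)) ∧ (∀ ω, Continuous fun t => Y t ω) ∧
      ∀ t, Y t =ᵐ[P] Z t := by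
  classical
  obtain ⟨x₀⟩ := ‹Nonempty X›
  let Z' : ι → Ω → X := fun t => (hm t).mk
  have hZ'm (t : ι) : Measurable (Z' t) := (hm t).measurable_mk
  have hZZ' (t : ι) : Z t =ᵐ[P] Z' t := (hm t).ae_eq_mk
  have hZ' : UniformContinuousInProbability P Z' := hZ.congr hZZ'
  obtain ⟨S, hSc, hSd⟩ := TopologicalSpace.exists_countable_dense ι
  have hae := hZ'.ae_uniformContinuous hSc
  -- A measurable null set containing all bad paths, so that redefining the process there keeps it
  -- measurable.
  set B := toMeasurable P {ω | ¬ UniformContinuous fun d : S => Z' d ω} with hB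
  have hBm : MeasurableSet B := measurableSet_toMeasurable _ _
  have hB0 : P B = 0 := by rw [hB, measure_toMeasurable]; exact ae_iff.1 hae
  have hBuc (ω : Ω) (hω : ω ∉ B) : UniformContinuous fun d : S => Z' d ω := by
    by_contra h
    exact hω (subset_toMeasurable _ _ h)
  let Y : ι → Ω → X := fun t ω => if ω ∈ B then x₀ else hSd.extend (fun d : S => Z' d ω) t
  have hYc (ω : Ω) : Continuous fun t => Y t ω := by
    by_cases h : ω ∈ B
    · simp only [Y, if_pos h]; exact continuous_const
    · simp only [Y, if_neg h]; exact (hSd.uniformContinuous_extend (hBuc ω h)).continuous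
  have hYS (ω : Ω) (hω : ω ∉ B) (d : S) : Y d ω = Z' d ω := by
    simp only [Y, if_neg hω]
    exact hSd.extend_eq (hBuc ω hω).continuous d
  have hseq (t : ι) : ∃ d : ℕ → S, Tendsto (fun n => (d n : ι)) atTop (𝓝 t) := by
    obtain ⟨u, hu, hut⟩ := mem_closure_iff_seq_limit.1 (hSd t)
    exact ⟨fun n => ⟨u n, hu n⟩, hut⟩
  have hYlim (t : ι) (d : ℕ → S) (hd : Tendsto (fun n => (d n : ι)) atTop (𝓝 t)) (ω : Ω)
      (hω : ω ∉ B) : Tendsto (fun n => Z' (d n) ω) atTop (𝓝 (Y t ω)) := by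
    have := ((hYc ω).tendsto t).comp hd
    exact this.congr fun n => hYS ω hω (d n)
  have hYm (t : ι) : Measurable (Y t) := by
    obtain ⟨d, hd⟩ := hseq t
    refine measurable_of_tendsto_metrizable
      (f := fun n ω => if ω ∈ B then x₀ else Z' (d n) ω)
      (fun n => Measurable.ite hBm measurable_const (hZ'm _)) (tendsto_pi_nhds.2 fun ω => ?_)
    by_cases h : ω ∈ B
    · simp only [Y, if_pos h]; exact tendsto_const_nhds
    · simp only [if_neg h]; exact hYlim t d hd ω h
  refine ⟨Y, hYm, hYc, fun t => ?_⟩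
  refine EventuallyEq.trans ?_ (hZZ' t).symm
  obtain ⟨d, hd⟩ := hseq t
  have h0 : ∀ᵐ ω ∂P, ω ∉ B := measure_eq_zero_iff_ae_notMem.1 hB0
  -- Uniform continuity along `S` with the one point `t` added identifies the extension at `t` with
  -- the original variable.
  filter_upwards [h0, hZ'.ae_uniformContinuous (hSc.insert t)] with ω hω huc
  refine tendsto_nhds_unique (hYlim t d hd ω hω) ?_
  have h1 : Tendsto (fun n => (⟨d n, Set.mem_insert_of_mem t (d n).2⟩ : (insert t S : Set ι)))
      atTop (𝓝 ⟨t, Set.mem_insert t S⟩) := tendsto_subtype_rng.2 hd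
  exact (huc.continuous.tendsto _).comp h1

/-! ### Integral processes of radonifying operators and their maximal inequality -/

section StochIntegralProcess

variable {Ω K E : Type*} [MeasurableSpace Ω] {P : Measure Ω} [IsProbabilityMeasure P]
  [NormedAddCommGroup K] [InnerProductSpace ℝ K]
  [AddCommGroup E] [Module ℝ E] [MetricSpace E] [Norm E]
  [MeasurableSpace E] [BorelSpace E] [IsTopologicalAddGroup E] [ContinuousSMul ℝ E]
  [SecondCountableTopology E] {W : K → Lp ℝ 2 P}
  {ι : Type*} [LinearOrder ι] {A : ι → K →ₗ[ℝ] K}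

theorem gammaNorm_sub_finiteRankOp_comp_le (r : ℝ) [RNormedSpace r E] {A : K →ₗ[ℝ] K}
    (hA : A.IsSymmetricProjection) (R : K →ₗ[ℝ] E) {N : ℕ} (h : Fin N → K) (x : Fin N → E) :
    gammaNorm 2 (R ∘ₗ A - finiteRankOp (fun n => A (h n)) x) ^ (2 : ℝ) ≤
      quasiConst r 2 * 2 * gammaNorm 2 (R - finiteRankOp h x) ^ (2 : ℝ) := by
  rw [← finiteRankOp_comp h x hA.isSymmetric, ← LinearMap.sub_comp]
  exact gammaNorm_comp_projection_le r two_pos _ hA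

theorem IsGammaRadonifying.exists_isStochIntegral_comp (r : ℝ) [RNormedSpace r E] [CompleteSpace E]
    (hW : IsIsonormal W) {R : K →ₗ[ℝ] E} (hR : IsGammaRadonifying R) {A : K →ₗ[ℝ] K}
    (hA : A.IsSymmetricProjection) : ∃ X, IsStochIntegral W (R ∘ₗ A) X := by
  obtain ⟨C, N, h, hC, -, hγ⟩ := hR.exists_approx r
  refine exists_isStochIntegral r hW (C := quasiConst r 2 * 2 * C)
    (h := fun k n => A (h k n)) (x := fun k n => R (h k n))
    (ENNReal.mul_ne_top (ENNReal.mul_ne_top (quasiConst_ne_top r 2) (by norm_num)) hC) fun k => ?_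
  refine (gammaNorm_sub_finiteRankOp_comp_le r hA R (h k) _).trans ?_
  rw [mul_assoc _ C]
  gcongr
  exact hγ k

/-- One sequence of approximants of `R`, independent of the projection, serves all times; this
allows passing to the limit in suprema over finite sets of times. -/
theorem IsGammaRadonifying.ae_tendsto_process (r : ℝ) [RNormedSpace r E]
    (hW : IsIsonormal W) {R : K →ₗ[ℝ] E} {A : K →ₗ[ℝ] K}
    (hA : A.IsSymmetricProjection) {X : Ω → E} (hX : IsStochIntegral W (R ∘ₗ A) X) {N : ℕ → ℕ}
    {h : ∀ k, Fin (N k) → K} {x : ∀ k, Fin (N k) → E} {C : ℝ≥0∞} (hC : C ≠ ∞)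
    (hγ : ∀ k, gammaNorm 2 (R - finiteRankOp (h k) (x k)) ^ (2 : ℝ) ≤ C * (1 / 4) ^ k) :
    ∀ᵐ ω ∂P, Tendsto (fun k => finiteRankIntegral W (fun n => A (h k n)) (x k) ω) atTop
      (𝓝 (X ω)) := by
  refine hX.ae_tendsto r hW (C := quasiConst r 2 * 2 * C)
    (ENNReal.mul_ne_top (ENNReal.mul_ne_top (quasiConst_ne_top r 2) (by norm_num)) hC) fun k => ?_
  refine (gammaNorm_sub_finiteRankOp_comp_le r hA R (h k) _).trans ?_
  rw [mul_assoc _ C]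
  gcongr
  exact hγ k

theorem aemeasurable_finset_sup {f : ι → Ω → ℝ≥0∞} (D : Finset ι)
    (hf : ∀ t ∈ D, AEMeasurable (f t) P) : AEMeasurable (fun ω => D.sup fun t => f t ω) P := by
  have : (fun ω => D.sup fun t => f t ω) = fun ω => ⨆ t ∈ D, f t ω :=
    funext fun ω => Finset.sup_eq_iSup _ _
  rw [this]
  exact AEMeasurable.biSup _ D.countable_toSet hf

/-- The maximal inequality for stochastic integral processes. -/
theorem IsGammaRadonifying.lintegral_sup_le (r : ℝ) [RNormedSpace r E] (hW : IsIsonormal W)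
    (hA : IsResolution A) {R : K →ₗ[ℝ] E} (hR : IsGammaRadonifying R) {Y : ι → Ω → E}
    (hY : ∀ t, IsStochIntegral W (R ∘ₗ A t) (Y t)) {p : ℝ} (hp : 0 < p) (D : Finset ι) :
    ∫⁻ ω, D.sup (fun t => rnorm (Y t ω) ^ p) ∂P ≤ levyConst r p * gammaNorm p R ^ p := by
  obtain ⟨C, N, h, hC, hh, hγ⟩ := hR.exists_approx r
  refine lintegral_le_of_tendsto_ae (f := fun k ω => D.sup fun t =>
    rnorm (finiteRankIntegral W (fun n => A t (h k n)) (fun n => R (h k n)) ω) ^ p)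
    (fun k => aemeasurable_finset_sup D fun t _ =>
      aemeasurable_rnorm_rpow r p (aemeasurable_finiteRankIntegral W _ _)) ?_
    (Eventually.of_forall fun k => ?_)
  · have h1 : ∀ᵐ ω ∂P, ∀ t ∈ D, Tendsto (fun k => finiteRankIntegral W (fun n => A t (h k n))
        (fun n => R (h k n)) ω) atTop (𝓝 (Y t ω)) :=
      (ae_ball_iff D.countable_toSet).2 fun t _ => IsGammaRadonifying.ae_tendsto_process r hW
        (hA.isSymmetricProjection t) (hY t) hC hγ
    filter_upwards [h1] with ω hω
    have h2 := Filter.Tendsto.finset_sup_nhds (s := D) (f := fun t k =>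
      rnorm (finiteRankIntegral W (fun n => A t (h k n)) (fun n => R (h k n)) ω) ^ p)
      (g := fun t => rnorm (Y t ω) ^ p) fun t ht =>
        (ENNReal.continuous_rpow_const.comp (continuous_rnorm r)).tendsto _ |>.comp (hω t ht)
    refine h2.congr fun k => ?_
    rw [Finset.sup_apply]
  · refine (hW.lintegral_sup_le r hA hp (h k) (fun n => R (h k n)) D).trans ?_
    gcongr
    -- Because the coefficients are `R (h k n)` over an orthonormal family, the moment is bounded by
    -- the `γ^p`-norm of `R` with constant `1`.
    rw [hW.lintegral_finiteRankIntegral r p (hh k)]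
    exact gaussMoment_le hp R (hh k)

theorem IsGammaRadonifying.sub_finiteRankOp (r : ℝ) [RNormedSpace r E] (hW : IsIsonormal W)
    {R : K →ₗ[ℝ] E} (hR : IsGammaRadonifying R) {N : ℕ} {h : Fin N → K} {x : Fin N → E}
    (hfin : gammaNorm 2 (R - finiteRankOp h x) < ∞) :
    IsGammaRadonifying (R - finiteRankOp h x) := by
  refine ⟨hfin, fun ε hε => ?_⟩
  obtain ⟨N', h', x', -, hlt⟩ := hR.2 ε hε
  obtain ⟨M, e, y, he, hop, -⟩ := hW.exists_orthonormal (Fin.append h' h) (Fin.append x' (-x))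
  refine ⟨M, e, y, he, ?_⟩
  rwa [hop, finiteRankOp_append_neg, sub_sub_sub_cancel_right]

end StochIntegralProcess

/-! ### Uniform continuity in probability of the scalar processes -/

section ScalarProcess

variable {Ω K : Type*} [MeasurableSpace Ω] {P : Measure Ω} [IsProbabilityMeasure P]
  [NormedAddCommGroup K] [InnerProductSpace ℝ K] {W : K → Lp ℝ 2 P} {A : ℝ → K →ₗ[ℝ] K}

/-- Gaussian scaling. The fourth power turns into the square of an increment of `‖A t f‖ ^ 2`, so
sums over a partition vanish as the mesh shrinks; second moments would only give a bounded sum. -/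
theorem IsIsonormal.exists_fourth_moment_le (hW : IsIsonormal W) : ∃ C : ℝ≥0∞, C ≠ ∞ ∧
    ∀ f : K, ∫⁻ ω, rnorm (W f ω) ^ (4 : ℝ) ∂P ≤ C * ENNReal.ofReal (‖f‖ ^ 4) := by
  refine ⟨∫⁻ x : ℝ, rnorm x ^ (4 : ℝ) ∂(gaussianReal 0 1), ?_, fun f => ?_⟩
  · have h1 := (eLpNorm_lt_top_iff_lintegral_rpow_enorm_lt_top (by norm_num) (by norm_num)).1
      (memLp_id_gaussianReal' (μ := 0) (v := 1) 4 (by norm_num)).eLpNorm_lt_top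
    refine ne_of_lt (lt_of_eq_of_lt (lintegral_congr fun x => ?_) h1)
    rw [rnorm, ofReal_norm]
    norm_num
  · have hmap : gaussianReal 0 (‖f‖₊ ^ 2) = (gaussianReal 0 1).map (fun x => ‖f‖ * x) := by
      rw [gaussianReal_map_const_mul, mul_zero, mul_one]
      congr 1
    have hm : Measurable fun x : ℝ => rnorm x ^ (4 : ℝ) := (measurable_rnorm 1).pow_const (4 : ℝ)
    calc ∫⁻ ω, rnorm (W f ω) ^ (4 : ℝ) ∂P = ∫⁻ x, rnorm x ^ (4 : ℝ) ∂(P.map (W f)) :=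
          (lintegral_map' hm.aemeasurable (IsIsonormal.aemeasurable W f)).symm
      _ = ∫⁻ x, rnorm (‖f‖ * x) ^ (4 : ℝ) ∂(gaussianReal 0 1) := by
          rw [hW.map_eq, hmap, lintegral_map hm (by fun_prop)]
      _ = ∫⁻ x : ℝ, rnorm x ^ (4 : ℝ) * ENNReal.ofReal (‖f‖ ^ 4) ∂(gaussianReal 0 1) := by
          refine lintegral_congr fun x => ?_
          rw [← smul_eq_mul, rnorm_smul 1, ENNReal.mul_rpow_of_nonneg _ _ (by norm_num), mul_comm,
            abs_norm, ENNReal.ofReal_pow (norm_nonneg f)]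
          norm_num
      _ ≤ _ := (lintegral_mul_const _ hm).le

theorem IsIsonormal.ae_sub (hW : IsIsonormal W) (f g : K) :
    ∀ᵐ ω ∂P, W (f - g) ω = W f ω - W g ω := by
  have h : W (f - g) = W f - W g := map_sub hW.toLinearMap f g
  rw [h]
  exact Lp.coeFn_sub _ _

/-- Pythagoras: `A s f` is the orthogonal projection of `A t f`. This makes `‖A t f‖ ^ 2` increasing
in `t`. -/
theorem IsResolution.norm_sq_sub (hA : IsResolution A) {s t : ℝ} (hst : s ≤ t) (f : K) :
    ‖A t f - A s f‖ ^ 2 = ‖A t f‖ ^ 2 - ‖A s f‖ ^ 2 := by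
  have h1 : inner ℝ (A t f) (A s f) = ‖A s f‖ ^ 2 := by
    rw [← real_inner_self_eq_norm_sq, hA.isSymmetric t, hA.comp, min_eq_right hst,
      hA.isSymmetric s, hA.comp, min_self]
  rw [norm_sub_sq_real, h1]
  ring

/-- Tail bound for the oscillation of a scalar process over an interval. -/
theorem IsIsonormal.exists_measure_oscillation_le (hW : IsIsonormal W) (hA : IsResolution A)
    {ε : ℝ≥0∞} (hε : 0 < ε) (hεt : ε ≠ ∞) : ∃ C : ℝ≥0∞, C ≠ ∞ ∧ ∀ (f : K) (a b : ℝ), a ≤ b →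
      ∀ D : Finset ℝ, P {ω | ∃ t ∈ D, a ≤ t ∧ t ≤ b ∧ ε < edist (W (A t f) ω) (W (A a f) ω)} ≤
        C * ENNReal.ofReal (‖A b f - A a f‖ ^ 4) := by
  obtain ⟨C₄, hC₄, hmom⟩ := hW.exists_fourth_moment_le
  have hε4 : ε ^ (4 : ℝ) ≠ 0 := (ENNReal.rpow_pos hε hεt).ne'
  have hε4t : ε ^ (4 : ℝ) ≠ ∞ := ENNReal.rpow_ne_top_of_nonneg (by norm_num) hεt
  refine ⟨(ε ^ (4 : ℝ))⁻¹ * (levyConst 1 4 * C₄), ENNReal.mul_ne_top (ENNReal.inv_ne_top.2 hε4)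
    (ENNReal.mul_ne_top (levyConst_ne_top (by norm_num)) hC₄), fun f a b hab D => ?_⟩
  -- On `[a, b]` the increments from `a` form the process `W (A t g)`, so the maximal inequality
  -- applies with terminal vector `g`.
  set g := A b f - A a f with hg
  have hAg (t : ℝ) (hat : a ≤ t) (htb : t ≤ b) : A t g = A t f - A a f := by
    rw [hg, map_sub, hA.comp, hA.comp, min_eq_left htb, min_eq_right hat]
  let S : Finset ℝ := D.filter fun t => a ≤ t ∧ t ≤ b
  have hint (u : K) (ω : Ω) :
      finiteRankIntegral W (fun _ : Fin 1 => u) (fun _ => (1 : ℝ)) ω = W u ω := by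
    simp [finiteRankIntegral]
  have hsup := hW.lintegral_sup_le 1 hA (p := 4) (by norm_num) (fun _ : Fin 1 => g)
    (fun _ => (1 : ℝ)) S
  simp only [hint] at hsup
  have hsub : ({ω | ∃ t ∈ D, a ≤ t ∧ t ≤ b ∧ ε < edist (W (A t f) ω) (W (A a f) ω)} : Set Ω) ≤ᵐ[P]
      ({ω | ε ^ (4 : ℝ) ≤ S.sup fun t => rnorm (W (A t g) ω) ^ (4 : ℝ)} : Set Ω) := by
    have h1 : ∀ᵐ ω ∂P, ∀ t ∈ D, W (A t f - A a f) ω = W (A t f) ω - W (A a f) ω :=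
      (ae_ball_iff D.countable_toSet).2 fun t _ => hW.ae_sub _ _
    filter_upwards [h1] with ω hω
    rintro ⟨t, ht, hat, htb, hlt⟩
    have h2 := Finset.le_sup (f := fun t => rnorm (W (A t g) ω) ^ (4 : ℝ))
      (Finset.mem_filter.2 ⟨ht, hat, htb⟩ : t ∈ S)
    refine le_trans ?_ h2
    rw [hAg t hat htb, hω t ht]
    gcongr
    rw [← rnorm_rpow_eq_edist 1, ENNReal.rpow_one] at hlt
    exact hlt.le
  have hmarkov := mul_meas_ge_le_lintegral₀ (aemeasurable_finset_sup (P := P) S fun t _ =>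
    aemeasurable_rnorm_rpow 1 4 (IsIsonormal.aemeasurable W (A t g))) (ε ^ (4 : ℝ))
  calc P {ω | ∃ t ∈ D, a ≤ t ∧ t ≤ b ∧ ε < edist (W (A t f) ω) (W (A a f) ω)}
      ≤ P {ω | ε ^ (4 : ℝ) ≤ S.sup fun t => rnorm (W (A t g) ω) ^ (4 : ℝ)} := measure_mono_ae hsub
    _ = (ε ^ (4 : ℝ))⁻¹ * (ε ^ (4 : ℝ) *
        P {ω | ε ^ (4 : ℝ) ≤ S.sup fun t => rnorm (W (A t g) ω) ^ (4 : ℝ)}) := by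
        rw [← mul_assoc, ENNReal.inv_mul_cancel hε4 hε4t, one_mul]
    _ ≤ (ε ^ (4 : ℝ))⁻¹ * (levyConst 1 4 * (C₄ * ENNReal.ofReal (‖g‖ ^ 4))) := by
        refine mul_le_mul_right (hmarkov.trans (hsup.trans ?_)) _
        exact mul_le_mul_right (hmom g) _
    _ = _ := by ring

/-- The scalar processes `W (A_t f)` are uniformly continuous in probability. -/
theorem IsIsonormal.uniformContinuousInProbability (hW : IsIsonormal W) (hA : IsResolution A)
    (hAc : ∀ f, Continuous fun t => A t f) {T : ℝ} (hT : 0 < T) (f : K) :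
    UniformContinuousInProbability P fun (t : Set.Icc (0 : ℝ) T) ω => W (A t f) ω := by
  intro ε hε η hη
  -- Choosing `ε'` strictly below `ε / 2` keeps it finite even for `ε = ∞`.
  obtain ⟨ε', hε', hlt⟩ := exists_between (ENNReal.half_pos hε.ne')
  have hε2 : ε' + ε' ≤ ε := (add_le_add hlt.le hlt.le).trans_eq (ENNReal.add_halves ε)
  obtain ⟨C, hC, hosc⟩ := hW.exists_measure_oscillation_le hA hε' (ne_top_of_lt hlt)
  set F : ℝ → ℝ := fun t => ‖A t f‖ ^ 2 with hF
  have hFc : Continuous F := (hAc f).norm.pow 2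
  have hFle (t : ℝ) : F t ≤ ‖f‖ ^ 2 := by
    have h1 : inner ℝ (A t f) f = F t := by
      change _ = ‖A t f‖ ^ 2
      rw [← real_inner_self_eq_norm_sq, hA.isSymmetric t f (A t f), hA.comp, min_self,
        hA.isSymmetric t f f]
    have h2 := real_inner_le_norm (A t f) f
    have h3 : F t = ‖A t f‖ ^ 2 := rfl
    nlinarith [norm_nonneg (A t f), norm_nonneg f, sq_nonneg (‖A t f‖ - ‖f‖)]
  have hF0 (t : ℝ) : 0 ≤ F t := sq_nonneg _
  obtain ⟨κ, hκ, hκη⟩ : ∃ κ : ℝ, 0 < κ ∧ C * ENNReal.ofReal (κ * (2 * ‖f‖ ^ 2)) ≤ η := by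
    have h1 : Tendsto (fun κ : ℝ => C * ENNReal.ofReal (κ * (2 * ‖f‖ ^ 2))) (𝓝[>] 0) (𝓝 0) := by
      have h2 : Tendsto (fun κ : ℝ => ENNReal.ofReal (κ * (2 * ‖f‖ ^ 2))) (𝓝 0) (𝓝 0) := by
        have : Continuous fun κ : ℝ => ENNReal.ofReal (κ * (2 * ‖f‖ ^ 2)) :=
          ENNReal.continuous_ofReal.comp (by fun_prop)
        simpa using this.tendsto 0
      have h3 := ENNReal.Tendsto.const_mul (h2.mono_left nhdsWithin_le_nhds) (Or.inr hC)
        (f := 𝓝[>] (0 : ℝ))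
      rwa [mul_zero] at h3
    obtain ⟨κ, h4, h5⟩ := (((tendsto_order.1 h1).2 η hη).and self_mem_nhdsWithin).exists
    exact ⟨κ, h5, h4.le⟩
  -- The last window ends at `(M + 2) δ`, which lies beyond `T` but not beyond `3 T`.
  obtain ⟨δ₀, hδ₀, hunif⟩ := Metric.uniformContinuousOn_iff.1
    (isCompact_Icc.uniformContinuousOn_of_continuous (s := Set.Icc 0 (3 * T)) hFc.continuousOn) κ hκ
  obtain ⟨M, hM⟩ := exists_nat_gt (2 * T / δ₀)
  have hM0 : (0 : ℝ) < M := lt_of_le_of_lt (by positivity) hM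
  have hM1 : (1 : ℝ) ≤ M := by exact_mod_cast Nat.one_le_iff_ne_zero.2 (by rintro rfl; simp at hM0)
  set δ := T / M with hδ
  have hδ0 : 0 < δ := by positivity
  have hMδ : M * δ = T := by rw [hδ]; field_simp
  have h2δ : 2 * δ < δ₀ := by
    rw [div_lt_iff₀ hδ₀] at hM
    rw [hδ, ← mul_div_assoc, div_lt_iff₀ hM0]; linarith
  have hδT : δ ≤ T := by nlinarith
  refine ⟨δ, hδ0, fun D => ?_⟩
  set D' : Finset ℝ := D.map (Function.Embedding.subtype _) with hD'
  have hmem (t : Set.Icc (0 : ℝ) T) (ht : t ∈ D) : (t : ℝ) ∈ D' :=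
    Finset.mem_map.2 ⟨t, ht, rfl⟩
  -- Windows of length `2 δ` overlap: two times less than `δ` apart lie in a common window, the one
  -- given by the integer part of the smaller time divided by `δ`.
  let V : ℕ → Set Ω := fun i => {ω | ∃ t ∈ D', i * δ ≤ t ∧ t ≤ (i + 2) * δ ∧
    ε' < edist (W (A t f) ω) (W (A (i * δ) f) ω)}
  have hcover : oscillationSet (fun (t : Set.Icc (0 : ℝ) T) ω => W (A t f) ω) D δ ε ⊆
      ⋃ i ∈ Finset.range (M + 1), V i := by
    have key (s t : Set.Icc (0 : ℝ) T) (hs : s ∈ D) (ht : t ∈ D) (hst : (s : ℝ) ≤ t)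
        (hd : dist s t < δ) (ω : Ω) (hω : ε < edist (W (A s f) ω) (W (A t f) ω)) :
        ω ∈ ⋃ i ∈ Finset.range (M + 1), V i := by
      set i := ⌊(s : ℝ) / δ⌋₊ with hi
      have h1 : i * δ ≤ s := by
        have := Nat.floor_le (div_nonneg s.2.1 hδ0.le)
        rwa [le_div_iff₀ hδ0] at this
      have h2 : (s : ℝ) < (i + 1) * δ := by
        have := Nat.lt_floor_add_one ((s : ℝ) / δ)
        rwa [div_lt_iff₀ hδ0] at this
      have h3 : (t : ℝ) < s + δ := by
        rw [Subtype.dist_eq, Real.dist_eq, abs_sub_comm] at hd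
        linarith [le_abs_self ((t : ℝ) - s)]
      have hiM : i ∈ Finset.range (M + 1) := by
        rw [Finset.mem_range, Nat.lt_succ_iff, ← Nat.cast_le (α := ℝ)]
        refine le_of_mul_le_mul_right ?_ hδ0
        rw [hMδ]; exact h1.trans s.2.2
      refine Set.mem_iUnion₂.2 ⟨i, hiM, ?_⟩
      by_contra hcon
      have h4 (t : Set.Icc (0 : ℝ) T) (ht : t ∈ D) (ha : i * δ ≤ (t : ℝ))
          (hb : (t : ℝ) ≤ (i + 2) * δ) :
          edist (W (A t f) ω) (W (A (i * δ) f) ω) ≤ ε' := by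
        by_contra! hgt
        exact hcon ⟨t, hmem t ht, ha, hb, hgt⟩
      refine absurd hω (not_lt.2 ?_)
      calc edist (W (A s f) ω) (W (A t f) ω)
          ≤ edist (W (A s f) ω) (W (A (i * δ) f) ω) + edist (W (A t f) ω) (W (A (i * δ) f) ω) :=
            edist_triangle_right _ _ _
        _ ≤ ε' + ε' := add_le_add (h4 s hs h1 (by linarith)) (h4 t ht (by linarith) (by linarith))
        _ ≤ ε := hε2
    rintro ω ⟨s, hs, t, ht, hst, hω⟩
    rcases le_total (s : ℝ) t with h | h
    · exact key s t hs ht h hst ω hω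
    · exact key t s ht hs h (by rwa [dist_comm]) ω (by rwa [edist_comm])
  have hV (i : ℕ) (hi : i ∈ Finset.range (M + 1)) : P (V i) ≤
      C * ENNReal.ofReal (κ * (F ((i + 2) * δ) - F (i * δ))) := by
    have hle : (i : ℝ) * δ ≤ (i + 2) * δ := by nlinarith
    refine (hosc f (i * δ) ((i + 2) * δ) hle D').trans ?_
    gcongr
    have h1 := hA.norm_sq_sub hle f
    have h2 : F ((i + 2) * δ) - F (i * δ) ≤ κ := by
      have hiM : (i : ℝ) ≤ M := by exact_mod_cast Nat.lt_succ_iff.1 (Finset.mem_range.1 hi)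
      have hb1 : (i : ℝ) * δ ≤ T := by rw [← hMδ]; gcongr
      have h0 : 0 ≤ (i : ℝ) * δ := by positivity
      have := hunif ((i + 2) * δ) ⟨by positivity, by linarith⟩ (i * δ) ⟨h0, by linarith⟩ (by
        rw [Real.dist_eq, show ((i : ℝ) + 2) * δ - i * δ = 2 * δ by ring, abs_of_pos (by positivity)]
        exact h2δ)
      rw [Real.dist_eq] at this
      exact (le_abs_self _).trans this.le
    -- One factor of the squared increment is bounded by the modulus of continuity `κ`; the other is
    -- kept for telescoping.
    calc ‖A ((i + 2) * δ) f - A (i * δ) f‖ ^ 4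
        = (F ((i + 2) * δ) - F (i * δ)) * (F ((i + 2) * δ) - F (i * δ)) := by
          change _ = (‖A ((i + 2) * δ) f‖ ^ 2 - ‖A (i * δ) f‖ ^ 2) *
            (‖A ((i + 2) * δ) f‖ ^ 2 - ‖A (i * δ) f‖ ^ 2)
          rw [← h1]; ring
      _ ≤ κ * (F ((i + 2) * δ) - F (i * δ)) := by
          refine mul_le_mul_of_nonneg_right h2 ?_
          change 0 ≤ ‖A ((i + 2) * δ) f‖ ^ 2 - ‖A (i * δ) f‖ ^ 2
          rw [← h1]; positivity
  have hnn (i : ℕ) : 0 ≤ κ * (F ((i + 2) * δ) - F (i * δ)) := by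
    refine mul_nonneg hκ.le ?_
    change 0 ≤ ‖A ((i + 2) * δ) f‖ ^ 2 - ‖A (i * δ) f‖ ^ 2
    rw [← hA.norm_sq_sub (by nlinarith) f]; positivity
  have htel : ∑ i ∈ Finset.range (M + 1), (F ((i + 2) * δ) - F (i * δ)) ≤ 2 * ‖f‖ ^ 2 := by
    -- Double steps telescope after adding neighbouring values: `F_(i+2) - F_i = (F_(i+2) + F_(i+1))
    -- - (F_(i+1) + F_i)`.
    have h1 := Finset.sum_range_sub (fun i : ℕ => F ((i + 1) * δ) + F (i * δ)) (M + 1)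
    have h2 : ∑ i ∈ Finset.range (M + 1), (F ((i + 2) * δ) - F (i * δ)) =
        ∑ i ∈ Finset.range (M + 1), (F (((i + 1 : ℕ) + 1) * δ) + F ((i + 1 : ℕ) * δ) -
          (F ((i + 1) * δ) + F (i * δ))) := by
      refine Finset.sum_congr rfl fun i _ => ?_
      push_cast
      rw [show (i : ℝ) + 1 + 1 = i + 2 by ring]
      ring
    rw [h2, h1]
    have := hFle (((M + 1 : ℕ) + 1) * δ)
    have := hFle ((M + 1 : ℕ) * δ)
    have := hF0 (((0 : ℕ) + 1) * δ)
    have := hF0 ((0 : ℕ) * δ)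
    linarith
  calc P (oscillationSet (fun (t : Set.Icc (0 : ℝ) T) ω => W (A t f) ω) D δ ε)
      ≤ ∑ i ∈ Finset.range (M + 1), P (V i) :=
        (measure_mono hcover).trans (measure_biUnion_finset_le _ _)
    _ ≤ ∑ i ∈ Finset.range (M + 1), C * ENNReal.ofReal (κ * (F ((i + 2) * δ) - F (i * δ))) :=
        Finset.sum_le_sum hV
    _ = C * ENNReal.ofReal (κ * ∑ i ∈ Finset.range (M + 1), (F ((i + 2) * δ) - F (i * δ))) := by
        rw [← Finset.mul_sum, ← ENNReal.ofReal_sum_of_nonneg fun i _ => hnn i, ← Finset.mul_sum]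
    _ ≤ C * ENNReal.ofReal (κ * (2 * ‖f‖ ^ 2)) := by gcongr
    _ ≤ η := hκη

end ScalarProcess

/-! ### Continuity of vector-valued integral processes and suprema over all times -/

section ContinuousProcess

variable {Ω K E : Type*} [MeasurableSpace Ω] {P : Measure Ω} [IsProbabilityMeasure P]
  [NormedAddCommGroup K] [InnerProductSpace ℝ K]
  [AddCommGroup E] [Module ℝ E] [MetricSpace E] [Norm E]
  [MeasurableSpace E] [BorelSpace E] [IsTopologicalAddGroup E] [ContinuousSMul ℝ E]
  [SecondCountableTopology E] {W : K → Lp ℝ 2 P}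

theorem UniformContinuousInProbability.add (r : ℝ) [RNormedSpace r E] {ι : Type*}
    [PseudoMetricSpace ι] {Z Z' : ι → Ω → E} (hZ : UniformContinuousInProbability P Z)
    (hZ' : UniformContinuousInProbability P Z') :
    UniformContinuousInProbability P fun t ω => Z t ω + Z' t ω := by
  intro ε hε η hη
  have hε2 := ENNReal.half_pos hε.ne'
  have hη2 := ENNReal.half_pos hη.ne'
  obtain ⟨δ, hδ, H⟩ := hZ (ε / 2) hε2 (η / 2) hη2
  obtain ⟨δ', hδ', H'⟩ := hZ' (ε / 2) hε2 (η / 2) hη2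
  refine ⟨min δ δ', lt_min hδ hδ', fun D => ?_⟩
  have hsub : oscillationSet (fun t ω => Z t ω + Z' t ω) D (min δ δ') ε ⊆
      oscillationSet Z D δ (ε / 2) ∪ oscillationSet Z' D δ' (ε / 2) := by
    rintro ω ⟨s, hs, t, ht, hst, hω⟩
    by_contra hcon
    rw [Set.mem_union, not_or] at hcon
    have h1 : edist (Z s ω) (Z t ω) ≤ ε / 2 := by
      by_contra! hlt
      exact hcon.1 ⟨s, hs, t, ht, hst.trans_le (min_le_left _ _), hlt⟩
    have h2 : edist (Z' s ω) (Z' t ω) ≤ ε / 2 := by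
      by_contra! hlt
      exact hcon.2 ⟨s, hs, t, ht, hst.trans_le (min_le_right _ _), hlt⟩
    refine absurd hω (not_lt.2 ?_)
    calc edist (Z s ω + Z' s ω) (Z t ω + Z' t ω)
        ≤ edist (Z s ω) (Z t ω) + edist (Z' s ω) (Z' t ω) := by
          rw [edist_dist, edist_dist, edist_dist, ← ENNReal.ofReal_add dist_nonneg dist_nonneg]
          exact ENNReal.ofReal_le_ofReal (RNormedSpace.dist_add_add_le r _ _ _ _)
      _ ≤ ε / 2 + ε / 2 := add_le_add h1 h2
      _ = ε := ENNReal.add_halves ε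
  exact (measure_mono hsub).trans ((measure_union_le _ _).trans
    ((add_le_add (H D) (H' D)).trans_eq (ENNReal.add_halves η)))

theorem UniformContinuousInProbability.sum (r : ℝ) [RNormedSpace r E] {ι κ : Type*}
    [PseudoMetricSpace ι] {Z : κ → ι → Ω → E} (s : Finset κ)
    (hZ : ∀ n, UniformContinuousInProbability P (Z n)) :
    UniformContinuousInProbability P fun t ω => ∑ n ∈ s, Z n t ω := by
  classical
  induction s using Finset.induction_on with
  | empty =>
    refine fun ε _ η _ => ⟨1, one_pos, fun D => ?_⟩
    simp [oscillationSet]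
  | insert a s ha ih =>
    simp only [Finset.sum_insert ha]
    exact (hZ a).add r ih

/-- The map is Hölder of exponent `r` for the metric of `E`; this transfers uniform continuity in
probability from `W (A t f)` to its multiples of a vector. -/
theorem uniformContinuous_smul_right (r : ℝ) [RNormedSpace r E] (x : E) :
    UniformContinuous fun c : ℝ => c • x := by
  have hr := RNormedSpace.r_pos (r := r) E
  refine HolderWith.uniformContinuous (C := ⟨dist x 0, dist_nonneg⟩) (r := ⟨r, hr.le⟩) ?_ hr
  intro c d
  rw [edist_dist, RNormedSpace.dist_smul_smul_right r, mul_comm, ENNReal.ofReal_mul dist_nonneg,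
    ← ENNReal.ofReal_rpow_of_nonneg (abs_nonneg _) hr.le, edist_dist, Real.dist_eq]
  refine le_of_eq ?_
  congr 1
  exact ENNReal.ofReal_eq_coe_nnreal dist_nonneg

theorem IsResolution.comp_subtype {A : ℝ → K →ₗ[ℝ] K} (hA : IsResolution A) (T : ℝ) :
    IsResolution fun t : Set.Icc (0 : ℝ) T => A t where
  isSymmetric t := hA.isSymmetric t
  comp s t f := by
    rcases le_total s t with h | h
    · rw [min_eq_left h, hA.comp, min_eq_left (by exact h)]
    · rw [min_eq_right h, hA.comp, min_eq_right (by exact h)]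

/-- Stochastic integral processes are uniformly continuous in probability. -/
theorem IsGammaRadonifying.uniformContinuousInProbability (r : ℝ) [RNormedSpace r E]
    (hW : IsIsonormal W) {A : ℝ → K →ₗ[ℝ] K} (hA : IsResolution A)
    (hAc : ∀ f, Continuous fun t => A t f) {T : ℝ} (hT : 0 < T) {R : K →ₗ[ℝ] E}
    (hR : IsGammaRadonifying R) {Y : Set.Icc (0 : ℝ) T → Ω → E}
    (hY : ∀ t : Set.Icc (0 : ℝ) T, IsStochIntegral W (R ∘ₗ A t) (Y t)) :
    UniformContinuousInProbability P Y := by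
  have hr := RNormedSpace.r_pos (r := r) E
  obtain ⟨C, N, h, hC, -, hγ⟩ := hR.exists_approx r
  refine uniformContinuousInProbability_of_approx fun ε hε η hη => ?_
  have hC' : levyConst r 2 * C ≠ ∞ := ENNReal.mul_ne_top (levyConst_ne_top two_pos) hC
  have h4 : (1 / 4 : ℝ≥0∞) < 1 := by rw [one_div]; exact ENNReal.inv_lt_one.2 (by norm_num)
  -- The metric is the `r`-th power of the `r`-norm, so distance `ε` corresponds to the squared
  -- `r`-norm `ε^(2/r)`, to which Markov's inequality is applied.
  set e : ℝ≥0∞ := ε ^ (2 / r) with he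
  have he0 : e ≠ 0 := by
    rcases eq_or_ne ε ∞ with rfl | hεt
    · simp [he, hr]
    · exact (ENNReal.rpow_pos hε hεt).ne'
  obtain ⟨k, hk⟩ : ∃ k : ℕ, e⁻¹ * (levyConst r 2 * C * (1 / 4) ^ k) < η := by
    have h1 := ENNReal.Tendsto.const_mul (ENNReal.Tendsto.const_mul
      (ENNReal.tendsto_pow_atTop_nhds_zero_of_lt_one h4) (Or.inr hC'))
      (Or.inr (ENNReal.inv_ne_top.2 he0))
    rw [mul_zero, mul_zero] at h1
    exact ((tendsto_order.1 h1).2 η hη).exists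
  set Z : Set.Icc (0 : ℝ) T → Ω → E :=
    fun t => finiteRankIntegral W (fun n => A t (h k n)) fun n => R (h k n) with hZ
  refine ⟨Z, ?_, fun D => ?_⟩
  · exact UniformContinuousInProbability.sum r Finset.univ fun n =>
      (hW.uniformContinuousInProbability hA hAc hT (h k n)).comp
        (uniformContinuous_smul_right r (R (h k n)))
  set S := R - finiteRankOp (h k) (fun n => R (h k n)) with hS
  have hfin : gammaNorm 2 S < ∞ :=
    (ENNReal.rpow_lt_top_iff_of_pos two_pos).1 ((hγ k).trans_lt
      (ENNReal.mul_lt_top hC.lt_top (ENNReal.pow_lt_top (h4.trans ENNReal.one_lt_top))))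
  have hSR : IsGammaRadonifying S := hR.sub_finiteRankOp r hW hfin
  have hYZ (t : Set.Icc (0 : ℝ) T) :
      IsStochIntegral W (S ∘ₗ A t) (fun ω => Y t ω - Z t ω) := by
    rw [hS, LinearMap.sub_comp, finiteRankOp_comp _ _ (hA.isSymmetric t)]
    exact (hY t).sub r hW (isStochIntegral_finiteRankOp r hW _ _)
  have hsup := hSR.lintegral_sup_le r hW (hA.comp_subtype T) hYZ two_pos D
  rcases eq_or_ne ε ∞ with rfl | hεt
  · simp
  have het : e ≠ ∞ := ENNReal.rpow_ne_top_of_nonneg (by positivity) hεt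
  calc P {ω | ∃ t ∈ D, ε < edist (Y t ω) (Z t ω)}
      ≤ P {ω | e ≤ D.sup fun t => rnorm (Y t ω - Z t ω) ^ (2 : ℝ)} := by
        refine measure_mono ?_
        rintro ω ⟨t, ht, hlt⟩
        refine le_trans ?_ (Finset.le_sup (f := fun t => rnorm (Y t ω - Z t ω) ^ (2 : ℝ)) ht)
        rw [← rnorm_rpow_eq_edist r] at hlt
        have h1 := ENNReal.rpow_le_rpow hlt.le (show 0 ≤ 2 / r by positivity)
        rwa [← ENNReal.rpow_mul, mul_div_cancel₀ _ hr.ne'] at h1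
    _ = e⁻¹ * (e * P {ω | e ≤ D.sup fun t => rnorm (Y t ω - Z t ω) ^ (2 : ℝ)}) := by
        rw [← mul_assoc, ENNReal.inv_mul_cancel he0 het, one_mul]
    _ ≤ e⁻¹ * (levyConst r 2 * C * (1 / 4) ^ k) := by
        refine mul_le_mul_right ((mul_meas_ge_le_lintegral₀ (aemeasurable_finset_sup D fun t _ =>
          aemeasurable_rnorm_rpow r 2 (hYZ t).1) e).trans (hsup.trans ?_)) _
        rw [mul_assoc]
        exact mul_le_mul_right (hγ k) _
    _ ≤ η := hk.le

theorem iSup_eq_iSup_of_dense {ι : Type*} [TopologicalSpace ι] {g : ι → ℝ≥0∞} (hg : Continuous g)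
    {S : Set ι} (hS : Dense S) : ⨆ t, g t = ⨆ s : S, g s := by
  refine le_antisymm (iSup_le fun t => ?_) (iSup_le fun s => le_iSup g s)
  have h1 : IsClosed {t | g t ≤ ⨆ s : S, g s} := isClosed_le hg continuous_const
  have h2 : closure S ⊆ {t | g t ≤ ⨆ s : S, g s} :=
    closure_minimal (fun s hs => le_iSup (fun s : S => g s) ⟨s, hs⟩) h1
  exact h2 (hS t)

/-- The upper bound for the supremum of a process with continuous paths. -/
theorem lintegral_iSup_le_of_continuous {ι : Type*} [TopologicalSpace ι]
    [TopologicalSpace.SeparableSpace ι] {g : ι → Ω → ℝ≥0∞} (hg : ∀ ω, Continuous fun t => g t ω)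
    (hgm : ∀ t, AEMeasurable (g t) P) {C : ℝ≥0∞}
    (h : ∀ D : Finset ι, ∫⁻ ω, D.sup (fun t => g t ω) ∂P ≤ C) : ∫⁻ ω, ⨆ t, g t ω ∂P ≤ C := by
  classical
  obtain ⟨S, hSc, hSd⟩ := TopologicalSpace.exists_countable_dense ι
  have : Countable S := hSc
  have hmap (D : Finset S) (ω : Ω) : (D.sup fun s => g s ω) =
      (D.map (Function.Embedding.subtype _) : Finset ι).sup fun t => g t ω := by
    rw [Finset.sup_map]; rfl
  calc ∫⁻ ω, ⨆ t, g t ω ∂P = ∫⁻ ω, ⨆ D : Finset S, D.sup (fun s => g s ω) ∂P := by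
        refine lintegral_congr fun ω => ?_
        rw [iSup_eq_iSup_of_dense (hg ω) hSd, iSup_eq_iSup_finset]
        simp_rw [Finset.sup_eq_iSup]
    _ = ⨆ D : Finset S, ∫⁻ ω, D.sup (fun s => g s ω) ∂P := by
        refine lintegral_iSup_directed (fun D => ?_) ?_
        · have h1 : (fun ω => D.sup fun s => g s ω) = fun ω => ⨆ s ∈ D, g s ω :=
            funext fun ω => Finset.sup_eq_iSup _ _
          rw [h1]
          exact AEMeasurable.biSup _ D.countable_toSet fun s _ => hgm s
        · exact Monotone.directed_le fun D D' hDD' ω => Finset.sup_mono hDD'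
    _ ≤ C := iSup_le fun D => by simp_rw [hmap]; exact h _

end ContinuousProcess

/-! ### The lower bound by reflection -/

section LowerBound

variable {Ω K E : Type*} [MeasurableSpace Ω] {P : Measure Ω} [IsProbabilityMeasure P]
  [NormedAddCommGroup K] [InnerProductSpace ℝ K]
  [AddCommGroup E] [Module ℝ E] [MetricSpace E] [Norm E]
  [MeasurableSpace E] [BorelSpace E] [IsTopologicalAddGroup E] [ContinuousSMul ℝ E]
  [SecondCountableTopology E] {W : K → Lp ℝ 2 P}

theorem IsIsonormal.map_finiteRankIntegral_isometry (hW : IsIsonormal W) {U : K →ₗ[ℝ] K}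
    (hU : ∀ f g, inner ℝ (U f) (U g) = inner ℝ f g) {N : ℕ} (h : Fin N → K) (x : Fin N → E) :
    P.map (finiteRankIntegral W (fun n => U (h n)) x) = P.map (finiteRankIntegral W h x) := by
  have hm : Measurable fun g : Fin N → ℝ => ∑ n, g n • x n :=
    (by fun_prop : Continuous fun g : Fin N → ℝ => ∑ n, g n • x n).measurable
  have h1 (a : Fin N → K) : P.map (finiteRankIntegral W a x) =
      (P.map fun ω i => W (a i) ω).map fun g => ∑ n, g n • x n :=
    (AEMeasurable.map_map_of_aemeasurable hm.aemeasurable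
      (IsIsonormal.aemeasurable_pi W a)).symm
  rw [h1, h1, hW.map_pi_eq fun i j => hU (h i) (h j)]

/-- The law of the stochastic integral is invariant under symmetric isometries. -/
theorem IsGammaRadonifying.map_eq_of_isometry (r : ℝ) [RNormedSpace r E] (hW : IsIsonormal W)
    {R : K →ₗ[ℝ] E} (hR : IsGammaRadonifying R) {U : K →ₗ[ℝ] K} (hUs : U.IsSymmetric)
    (hU : ∀ f g, inner ℝ (U f) (U g) = inner ℝ f g) {X X' : Ω → E} (hX : IsStochIntegral W R X)
    (hX' : IsStochIntegral W (R ∘ₗ U) X') : P.map X = P.map X' := by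
  obtain ⟨C, N, h, hC, -, hγ⟩ := hR.exists_approx r
  have h1 := hX.ae_tendsto r hW hC hγ
  have h2 := hX'.ae_tendsto r hW (h := fun k n => U (h k n)) (x := fun k n => R (h k n)) hC
    fun k => by
      rw [← finiteRankOp_comp _ _ hUs, ← LinearMap.sub_comp]
      exact (gammaNorm_comp_isometry_le two_pos _ hU).trans (hγ k)
  have t1 := tendstoInDistribution_of_ae_tendsto
    (fun k => aemeasurable_finiteRankIntegral W (h k) fun n => R (h k n)) hX.1 h1
  have t2 := tendstoInDistribution_of_ae_tendsto
    (fun k => aemeasurable_finiteRankIntegral W (fun n => U (h k n)) fun n => R (h k n)) hX'.1 h2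
  -- Both integrals are almost sure limits of finite rank integrals whose laws coincide index by
  -- index, so the limits have the same law.
  refine tendstoInDistribution_unique _ t1 ⟨t1.forall_aemeasurable, hX'.1, ?_⟩
  refine t2.tendsto.congr fun k => Subtype.ext ?_
  exact hW.map_finiteRankIntegral_isometry hU (h k) _

/-- Reflection takes the place of conditioning on the `W (f n)`: with `Q` the projection onto their
span, `X` and `X' = 2 ∑ W(f_n) R f_n - X` are equally distributed, since `X'` is an integral of `R`
composed with the reflection of `Q`. Their sum is twice the Gaussian sum. -/
theorem two_rpow_mul_gaussMoment_le (r : ℝ) [RNormedSpace r E] (hW : IsIsonormal W)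
    {R : K →ₗ[ℝ] E} (hR : IsGammaRadonifying R) {X : Ω → E} (hX : IsStochIntegral W R X) {p : ℝ}
    (hp : 0 < p) {N : ℕ} {f : Fin N → K} (hf : Orthonormal ℝ f) :
    2 ^ p * gaussMoment p (fun n => R (f n)) ≤
      quasiConst r p * (2 * ∫⁻ ω, rnorm (X ω) ^ p ∂P) := by
  set Q : K →ₗ[ℝ] K := finiteRankOp f f with hQ
  have hQp := isSymmetricProjection_finiteRankOp hf
  set Z : Ω → E := finiteRankIntegral W f (fun n => (2 : ℝ) • R (f n)) with hZ
  set X' : Ω → E := fun ω => Z ω - X ω with hX'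
  have hop : finiteRankOp f (fun n => (2 : ℝ) • R (f n)) - R = R ∘ₗ reflectionOf Q := by
    ext g
    simp [finiteRankOp_apply, reflectionOf_apply, hQ, Finset.smul_sum, smul_comm (2 : ℝ)]
  have hXi : IsStochIntegral W (R ∘ₗ reflectionOf Q) X' := by
    rw [← hop]
    exact (isStochIntegral_finiteRankOp r hW f _).sub r hW hX
  have hsym : (reflectionOf Q).IsSymmetric := fun a b => by
    simp only [reflectionOf_apply, inner_sub_left, inner_sub_right, inner_smul_left,
      inner_smul_right, conj_trivial]
    rw [hQp.isSymmetric a b]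
  have hlaw := hR.map_eq_of_isometry r hW hsym (inner_reflectionOf hQp) hX hXi
  have hm : Measurable fun x : E => rnorm x ^ p := (measurable_rnorm r).pow_const p
  have heq : ∫⁻ ω, rnorm (X' ω) ^ p ∂P = ∫⁻ ω, rnorm (X ω) ^ p ∂P := by
    rw [← lintegral_map' (f := fun x : E => rnorm x ^ p) hm.aemeasurable hX.1,
      ← lintegral_map' (f := fun x : E => rnorm x ^ p) hm.aemeasurable hXi.1, hlaw]
  calc 2 ^ p * gaussMoment p (fun n => R (f n))
      = gaussMoment p (fun n => (2 : ℝ) • R (f n)) := by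
        rw [gaussMoment_smul r hp]; simp
    _ = ∫⁻ ω, rnorm (X ω + X' ω) ^ p ∂P := by
        rw [← hW.lintegral_finiteRankIntegral r p hf]
        simp [hX', hZ]
    _ ≤ quasiConst r p * (∫⁻ ω, rnorm (X ω) ^ p ∂P + ∫⁻ ω, rnorm (X' ω) ^ p ∂P) :=
        lintegral_rnorm_add_rpow_le r hp hX.1
    _ = _ := by rw [heq, two_mul]

theorem IsGammaRadonifying.gammaNorm_le (r : ℝ) [RNormedSpace r E] (hW : IsIsonormal W)
    {R : K →ₗ[ℝ] E} (hR : IsGammaRadonifying R) {X : Ω → E} (hX : IsStochIntegral W R X) {p : ℝ}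
    (hp : 0 < p) :
    gammaNorm p R ≤ 2 ^ ((1 - min r p) / min r p) * (∫⁻ ω, rnorm (X ω) ^ p ∂P) ^ (1 / p) := by
  have hs : 0 < min r p := lt_min (RNormedSpace.r_pos E) hp
  refine gammaNorm_le_of_rpow_le hp (gammaNorm_rpow_le hp fun N f hf => ?_)
  rw [ENNReal.mul_rpow_of_nonneg _ _ hp.le, one_div, ENNReal.rpow_inv_rpow hp.ne',
    ← ENNReal.rpow_mul]
  have h1 := two_rpow_mul_gaussMoment_le r hW hR hX hp hf
  have h2 : (2 : ℝ≥0∞) ^ (-p) * (2 ^ p * gaussMoment p fun n => R (f n)) ≤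
      2 ^ (-p) * (quasiConst r p * (2 * ∫⁻ ω, rnorm (X ω) ^ p ∂P)) := by gcongr
  rw [← mul_assoc, ← ENNReal.rpow_add _ _ (by norm_num) (by norm_num), neg_add_cancel,
    ENNReal.rpow_zero, one_mul] at h2
  refine h2.trans_eq ?_
  -- With `s = min r p` the powers of `2` add up to `-p + (p/s - 1) + 1`, that is, `p (1 - s) / s`.
  rw [quasiConst, ← mul_assoc, ← mul_assoc]
  congr 1
  nth_rw 3 [← ENNReal.rpow_one 2]
  rw [← ENNReal.rpow_add _ _ (by norm_num) (by norm_num),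
    ← ENNReal.rpow_add _ _ (by norm_num) (by norm_num)]
  congr 1
  field_simp
  ring

end LowerBound

/-! ### The cutoffs form a strongly continuous increasing family of projections -/

section Cutoff

variable {H : Type*} [NormedAddCommGroup H] [InnerProductSpace ℝ H] {T : ℝ}

theorem coeFn_cutoff (t : ℝ) (f : L2Time T H) :
    cutoff t f =ᵐ[volume.restrict (Set.Icc (0 : ℝ) T)] (Set.Icc (0 : ℝ) t).indicator f := by
  have h : MemLp ((Set.Icc (0 : ℝ) t).indicator f) 2 (volume.restrict (Set.Icc (0 : ℝ) T)) :=
    (Lp.memLp f).indicator measurableSet_Icc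
  exact h.coeFn_toLp

theorem inner_cutoff (t : ℝ) (f g : L2Time T H) : inner ℝ (cutoff t f) g =
    ∫ x in Set.Icc 0 t, (inner ℝ (f x) (g x) : ℝ) ∂(volume.restrict (Set.Icc (0 : ℝ) T)) := by
  rw [L2.inner_def (𝕜 := ℝ) (E := H), ← integral_indicator (measurableSet_Icc (a := (0 : ℝ)) (b := t))]
  refine integral_congr_ae ?_
  filter_upwards [coeFn_cutoff t f] with x hx
  rw [hx]
  by_cases h : x ∈ Set.Icc 0 t
  · simp only [Set.indicator_of_mem h]
  · simp only [Set.indicator_of_notMem h, inner_zero_left]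

theorem isResolution_cutoff :
    IsResolution fun t : ℝ => (cutoff t : L2Time T H →ₗ[ℝ] L2Time T H) where
  isSymmetric t f g := by
    rw [inner_cutoff, real_inner_comm, inner_cutoff]
    simp_rw [real_inner_comm]
  comp s t f := by
    refine Lp.ext ?_
    filter_upwards [coeFn_cutoff s (cutoff t f), coeFn_cutoff t f, coeFn_cutoff (min s t) f]
      with x h1 h2 h3
    rw [h1, h3]
    have h4 : (Set.Icc 0 s).indicator (cutoff t f) x =
        (Set.Icc 0 s).indicator ((Set.Icc 0 t).indicator f) x := by
      simp only [Set.indicator, h2]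
    rw [h4, Set.indicator_indicator, Set.Icc_inter_Icc, sup_idem]

theorem cutoff_self (f : L2Time T H) : cutoff T f = f := by
  refine Lp.ext ?_
  filter_upwards [coeFn_cutoff T f, ae_restrict_mem measurableSet_Icc] with x h1 h2
  rw [h1, Set.indicator_of_mem h2]

/-- As a primitive of an integrable function this is visibly continuous in `t`; the maximum with `0`
accounts for negative `t`, where the cutoff vanishes. -/
theorem norm_sq_cutoff (t : ℝ) (f : L2Time T H) : ‖cutoff t f‖ ^ 2 =
    ∫ x in (0 : ℝ)..max t 0, ‖f x‖ ^ 2 ∂(volume.restrict (Set.Icc (0 : ℝ) T)) := by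
  have h1 : ‖cutoff t f‖ ^ 2 = inner ℝ (cutoff t f) f := by
    rw [← real_inner_self_eq_norm_sq, isResolution_cutoff.isSymmetric t f (cutoff t f),
      isResolution_cutoff.comp, min_self, isResolution_cutoff.isSymmetric t f f]
  rw [h1, inner_cutoff, intervalIntegral.integral_of_le (le_max_right _ _),
    ← integral_Icc_eq_integral_Ioc]
  simp_rw [real_inner_self_eq_norm_sq]
  rcases le_total 0 t with h | h
  · rw [max_eq_left h]
  · rw [max_eq_right h, Set.Icc_self]
    rcases h.lt_or_eq with h | rfl
    · rw [Set.Icc_eq_empty (not_le.2 h)]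
      simp
    · rw [Set.Icc_self]

/-- By Pythagoras the norm of an increment is the square root of an increment of `‖cutoff t f‖ ^ 2`,
so continuity of that scalar function suffices. -/
theorem continuous_cutoff (f : L2Time T H) : Continuous fun t : ℝ => cutoff t f := by
  have hint : Integrable (fun x => ‖f x‖ ^ 2) (volume.restrict (Set.Icc (0 : ℝ) T)) :=
    (Lp.memLp f).integrable_norm_pow (by norm_num)
  have hF : Continuous fun t : ℝ => ‖cutoff t f‖ ^ 2 := by
    simp_rw [norm_sq_cutoff]
    exact (intervalIntegral.continuous_primitive (fun a b => hint.intervalIntegrable) 0).comp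
      (continuous_id.max continuous_const)
  refine continuous_iff_continuousAt.2 fun s => tendsto_iff_norm_sub_tendsto_zero.2 ?_
  have h1 : ∀ t, ‖cutoff t f - cutoff s f‖ = √|‖cutoff t f‖ ^ 2 - ‖cutoff s f‖ ^ 2| := by
    intro t
    rw [eq_comm, Real.sqrt_eq_iff_mul_self_eq (abs_nonneg _) (norm_nonneg _), ← sq]
    rcases le_total s t with h | h
    · rw [isResolution_cutoff.norm_sq_sub h, abs_of_nonneg]
      rw [← isResolution_cutoff.norm_sq_sub h]; positivity
    · rw [norm_sub_rev, isResolution_cutoff.norm_sq_sub h, abs_sub_comm, abs_of_nonneg]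
      rw [← isResolution_cutoff.norm_sq_sub h]; positivity
  simp_rw [h1]
  have h2 : Continuous fun t : ℝ => √|‖cutoff t f‖ ^ 2 - ‖cutoff s f‖ ^ 2| :=
    ((hF.sub continuous_const).abs).sqrt
  simpa using h2.tendsto s

end Cutoff

/-! ### Assembly of the theorem -/

theorem IsStochIntegral.congr {Ω K E : Type*} [MeasurableSpace Ω] {P : Measure Ω}
    [NormedAddCommGroup K] [InnerProductSpace ℝ K] [AddCommGroup E] [Module ℝ E] [Norm E]
    [MeasurableSpace E] {W : K → Lp ℝ 2 P} {R : K →ₗ[ℝ] E} {X X' : Ω → E}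
    (hX : IsStochIntegral W R X) (h : X =ᵐ[P] X') : IsStochIntegral W R X' := by
  obtain ⟨hm, N, e, x, he, h1, h2⟩ := hX
  refine ⟨hm.congr h, N, e, x, he, h1, h2.congr fun k => lintegral_congr_ae ?_⟩
  filter_upwards [h] with ω hω
  rw [hω]

theorem proposition3p8 {r : ℝ} {E : Type*} [AddCommGroup E] [Module ℝ E] [MetricSpace E] [Norm E]
    [RNormedSpace r E] [CompleteSpace E] [TopologicalSpace.SeparableSpace E]
    [MeasurableSpace E] [BorelSpace E]
    {H : Type*} [NormedAddCommGroup H] [InnerProductSpace ℝ H] [CompleteSpace H]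
    [TopologicalSpace.SeparableSpace H]
    {Ω : Type*} [MeasurableSpace Ω] {P : Measure Ω} [IsProbabilityMeasure P]
    {T : ℝ} (hT : 0 < T)
    (W : L2Time T H → Lp ℝ 2 P) (hW : IsIsonormal W)
    (R : L2Time T H →ₗ[ℝ] E) (hR : IsGammaRadonifying R) :
    (∃ Y : Set.Icc (0 : ℝ) T → Ω → E, IsStochIntegralProcess W R Y) ∧
    ∀ Y : Set.Icc (0 : ℝ) T → Ω → E, IsStochIntegralProcess W R Y →
      (∃ X : Set.Icc (0 : ℝ) T → Ω → E,
        (∀ t, Measurable (X t)) ∧ (∀ ω, Continuous fun t => X t ω) ∧ ∀ t, X t =ᵐ[P] Y t) ∧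
      ∀ X : Set.Icc (0 : ℝ) T → Ω → E,
        (∀ ω, Continuous fun t => X t ω) → (∀ t, X t =ᵐ[P] Y t) →
        ∀ p : ℝ, 0 < p →
          gammaNorm p R < ∞ ∧
          (2 : ℝ≥0∞) ^ (-((1 - min r p) / min r p)) * gammaNorm p R ≤
            (∫⁻ ω, ⨆ t, ENNReal.ofReal ‖X t ω‖ ^ p ∂P) ^ (1 / p) ∧
          (∫⁻ ω, ⨆ t, ENNReal.ofReal ‖X t ω‖ ^ p ∂P) ^ (1 / p) ≤
            (2 : ℝ≥0∞) ^ (1 / p + 1 / r - 1) * gammaNorm p R := by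
  have := RNormedSpace.isTopologicalAddGroup r (E := E)
  have := RNormedSpace.continuousSMul r (E := E)
  have : SecondCountableTopology E := UniformSpace.secondCountable_of_separable E
  have hA : IsResolution fun t : ℝ => (cutoff t : L2Time T H →ₗ[ℝ] L2Time T H) :=
    isResolution_cutoff
  constructor
  · choose Y hY using fun t : Set.Icc (0 : ℝ) T =>
      hR.exists_isStochIntegral_comp r hW (hA.isSymmetricProjection t)
    exact ⟨Y, hY⟩
  intro Y hY
  refine ⟨?_, fun X hXc hXY p hp => ⟨gammaNorm_lt_top r hR.1 hp, ?_, ?_⟩⟩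
  · exact (hR.uniformContinuousInProbability r hW hA continuous_cutoff hT
      hY).exists_continuous_modification fun t => (hY t).1
  · have hXT : IsStochIntegral W R (X ⟨T, hT.le, le_rfl⟩) := by
      have h1 := (hY ⟨T, hT.le, le_rfl⟩).congr (hXY _).symm
      have h2 : R ∘ₗ (cutoff T : L2Time T H →ₗ[ℝ] L2Time T H) = R :=
        LinearMap.ext fun f => congrArg R (cutoff_self f)
      rwa [h2] at h1
    calc (2 : ℝ≥0∞) ^ (-((1 - min r p) / min r p)) * gammaNorm p R
        ≤ 2 ^ (-((1 - min r p) / min r p)) * (2 ^ ((1 - min r p) / min r p) *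
          (∫⁻ ω, rnorm (X ⟨T, hT.le, le_rfl⟩ ω) ^ p ∂P) ^ (1 / p)) := by
          gcongr
          exact hR.gammaNorm_le r hW hXT hp
      _ = (∫⁻ ω, rnorm (X ⟨T, hT.le, le_rfl⟩ ω) ^ p ∂P) ^ (1 / p) := by
          rw [← mul_assoc, ← ENNReal.rpow_add _ _ (by norm_num) (by norm_num), neg_add_cancel,
            ENNReal.rpow_zero, one_mul]
      _ ≤ _ := ENNReal.rpow_le_rpow (lintegral_mono fun ω =>
          le_iSup (fun t => rnorm (X t ω) ^ p) _) (by positivity)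
  · have hXi (t : Set.Icc (0 : ℝ) T) : IsStochIntegral W (R ∘ₗ cutoff (t : ℝ)) (X t) :=
      (hY t).congr (hXY t).symm
    have h1 : ∫⁻ ω, ⨆ t, rnorm (X t ω) ^ p ∂P ≤ levyConst r p * gammaNorm p R ^ p :=
      lintegral_iSup_le_of_continuous
        (fun ω => ENNReal.continuous_rpow_const.comp ((continuous_rnorm r).comp (hXc ω)))
        (fun t => aemeasurable_rnorm_rpow r p (hXi t).1)
        fun D => hR.lintegral_sup_le r hW (hA.comp_subtype T) hXi hp D
    refine (ENNReal.rpow_le_rpow h1 (by positivity)).trans_eq ?_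
    rw [levyConst, one_div p, ENNReal.mul_rpow_of_nonneg _ _ (by positivity),
      ENNReal.rpow_rpow_inv hp.ne', ENNReal.mul_rpow_of_nonneg _ _ (by positivity),
      ENNReal.rpow_rpow_inv hp.ne', ← ENNReal.rpow_add _ _ (by norm_num) (by norm_num)]
    congr 2
    ring
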